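/- **Notation.** Let $\mathbb S_n$ be the set of strict partitions $\lambda=(\lambda_1>\dots>\lambda_\ell>0)$ of $n$, with $\ell(\lambda)=\ell$ and $|\lambda|=n$, identified with shifted Young diagrams (row $i$ is shifted $i-1$ steps to the right); write $\mu\Nearrow\lambda$ if $\lambda$ is obtained from $\mu$ by adding one box to the shifted diagram. The content of a box is its column number minus its row number. Let $g_\lambda$ be the number of paths $\varnothing\Nearrow\dots\Nearrow\lambda$. For $\alpha>0$ the measures $\mathbb M_n^\alpha$ on $\mathbb S_n$ are defined by $\mathbb M_0^\alpha(\varnothing)=1$ and $\mathbb M_{n+1}^\alpha(\lambda)=\sum_{\mu\Nearrow\lambda}\mathbb M_n^\alpha(\mu)\,p^{\Uparrow}_\alpha(\mu,\lambda)$, where, $c$ being the content of the box $\lambda\setminus\mu$, $$p^{\Uparrow}_\alpha(\mu,\lambda)=\frac{c(c+1)+\alpha}{2|\mu|+\alpha}\cdot\frac{g_\lambda}{(|\mu|+1)\,g_\mu}\,2^{\ell(\mu)-\ell(\lambda)+1}.$$ Similarly, write $\sigma\nearrow\rho$ if the ordinary Young diagram $\rho$ is obtained from $\sigma$ by adding one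 box, and let $f_\rho$ be the number of paths $\varnothing\nearrow\dots\nearrow\rho$. The $z$-measures $\mathrm M_n^{z,z'}$ on Young diagrams with $n$ boxes are defined by $\mathrm M_0^{z,z'}(\varnothing)=1$ and $\mathrm M_{n+1}^{z,z'}(\rho)=\sum_{\sigma\nearrow\rho}\mathrm M_n^{z,z'}(\sigma)\,p^{\uparrow}_{z,z'}(\sigma,\rho)$, where, $c$ being the content of the box $\rho\setminus\sigma$, $$p^{\uparrow}_{z,z'}(\sigma,\rho)=\frac{(z+c)(z'+c)}{zz'+|\sigma|}\cdot\frac{f_\rho}{(|\sigma|+1)f_\sigma}.$$ For $\lambda\in\mathbb S_n$ let $\mathcal D\lambda$ be its doubling, the ordinary Young diagram with $2n$ boxes and Frobenius coordinates $(\lambda_1,\dots,\lambda_\ell\mid\lambda_1-1,\dots,\lambda_\ell-1)$. For $z\in\mathbb C$ and a symmetric function $F$, let $F(\underbrace{1,\dots,1}_{z\text{ times}})$ be the image of $F$ under the algebra homomorphism that sends every power sum $p_k$, $k\ge1$, to $z$. Let $s_\rho$ be the Schur functions and $(a)_n=a(a+1)\cdots(a+n-1)$. Finally put $\nu(\alpha)=\tfrac12\sqrt{1-4\alpha}$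 (a complex square root), $z(\alpha)=\nu(\alpha)-\tfrac12$ and $z'(\alpha)=-\nu(\alpha)-\tfrac12$. **Theorem.** Let $\alpha>0$ and $n\ge0$. 1. For all $\lambda\in\mathbb S_n$, $$\mathbb M_n^\alpha(\lambda)=\frac{(-1)^n\,n!}{(\alpha/2)_n}\;s_{\mathcal D\lambda}(\underbrace{1,\dots,1}_{\nu(\alpha)-\frac12\text{ times}}).$$ 2. All weights $\mathrm M_{2n}^{z(\alpha),z'(\alpha)}(\mathcal D\lambda)$, $\lambda\in\mathbb S_n$, are positive real numbers, and there is a constant $C>0$, depending only on $\alpha$ and $n$, such that for all $\lambda\in\mathbb S_n$ $$\mathbb M_n^\alpha(\lambda)=C\,\sqrt{\mathrm M_{2n}^{z(\alpha),z'(\alpha)}(\mathcal D\lambda)}.$$ -/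

import Mathlib

open scoped Nat
open MvPolynomial (X aeval)

noncomputable section

namespace StrictDoubling

/-! ### Growth on graded graphs -/

/-- `GraphPath E root v` is the type of paths `root → ⋯ → v` along the edges of the
directed graph `E`. -/
inductive GraphPath {V : Type} (E : V → V → Prop) (root : V) : V → Type
  | nil : GraphPath E root root
  | cons {u v : V} (p : GraphPath E root u) (h : E u v) : GraphPath E root v

/-- The number of paths from `root` to `v`. -/
def numPaths {V : Type} (E : V → V → Prop) (root v : V) : ℕ :=
  Nat.card (GraphPath E root v)

open Classical in
/-- The distribution after `n` steps of the growth process that starts at `root` and moves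
from `u` to `v` with probability `p u v`, that is `M₀ = δ_root` and `Mₙ₊₁ = Mₙ ∘ p`.
It is used for kernels with `p u v = 0` unless `u ⊂ v`, so that each sum is finite. -/
def growth {V 𝕜 : Type} [Semiring 𝕜] (p : V → V → 𝕜) (root : V) : ℕ → V → 𝕜
  | 0, v => if v = root then 1 else 0
  | n + 1, v => ∑ᶠ u, growth p root n u * p u v

/-! ### Ordinary Young diagrams (boxes are indexed from `(0, 0)`) -/

/-- The content (column number minus row number) of a box. -/
def content (b : ℕ × ℕ) : ℤ := (b.2 : ℤ) - b.1

/-- `σ ↗ ρ`: the diagram `ρ` is obtained from `σ` by adding one box. -/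
def YoungEdge (σ ρ : YoungDiagram) : Prop :=
  σ.cells ⊆ ρ.cells ∧ ρ.card = σ.card + 1

/-- `f_ρ`, the number of paths from `∅` to `ρ` in the Young graph. -/
def youngDim (ρ : YoungDiagram) : ℕ := numPaths YoungEdge ⊥ ρ

/-- The content of the box `ρ \ σ`, for `σ ↗ ρ` (the sum has exactly one term). -/
def youngAddedContent (σ ρ : YoungDiagram) : ℤ := ∑ b ∈ ρ.cells \ σ.cells, content b

open Classical in
/-- The up transition probabilities of the `z`-measures. -/
def zUp (z z' : ℂ) (σ ρ : YoungDiagram) : ℂ :=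
  if YoungEdge σ ρ then
    (z + youngAddedContent σ ρ) * (z' + youngAddedContent σ ρ) / (z * z' + σ.card)
      * (youngDim ρ / ((σ.card + 1) * youngDim σ))
  else 0

/-- The weight `M_n^{z,z'}(ρ)` of the `z`-measure on Young diagrams with `n` boxes. -/
def zMeasure (z z' : ℂ) (n : ℕ) (ρ : YoungDiagram) : ℂ := growth (zUp z z') ⊥ n ρ

/-! ### Strict partitions and shifted Young diagrams -/

/-- A strict partition: a partition whose nonzero parts are distinct. The underlying partition
is kept as the ordinary (unshifted) diagram with the same rows. -/
structure StrictPartition where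
  diagram : YoungDiagram
  strict : ∀ i j, i < j → 0 < diagram.rowLen j → diagram.rowLen j < diagram.rowLen i

namespace StrictPartition

/-- The part `λ_{i+1}`. -/
def part (lam : StrictPartition) (i : ℕ) : ℕ := lam.diagram.rowLen i

/-- The weight `|λ|`. -/
def weight (lam : StrictPartition) : ℕ := lam.diagram.card

/-- The number `ℓ(λ)` of nonzero parts. -/
def length (lam : StrictPartition) : ℕ := lam.diagram.colLen 0

/-- The empty partition. -/
def empty : StrictPartition where
  diagram := ⊥
  strict := by
    intro i j _ h
    exact absurd (YoungDiagram.mem_iff_lt_rowLen.2 h) (YoungDiagram.notMem_bot _)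

/-- The boxes of the shifted diagram: row `i` is moved `i` steps to the right. -/
def shiftedCells (lam : StrictPartition) : Finset (ℕ × ℕ) :=
  lam.diagram.cells.image fun b => (b.1, b.1 + b.2)

/-- `μ ⇗ λ`: the shifted diagram of `λ` is obtained from that of `μ` by adding one box. -/
def Edge (mu lam : StrictPartition) : Prop :=
  mu.shiftedCells ⊆ lam.shiftedCells ∧ lam.weight = mu.weight + 1

/-- `g_λ`, the number of paths from `∅` to `λ` in the Schur graph. -/
def dim (lam : StrictPartition) : ℕ := numPaths Edge empty lam

/-- The content of the box `λ \ μ` of the shifted diagrams, for `μ ⇗ λ` (the sum has exactly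
one term). -/
def addedContent (mu lam : StrictPartition) : ℤ :=
  ∑ b ∈ lam.shiftedCells \ mu.shiftedCells, content b

/-- The formula for the Plancherel up transition probabilities on the Schur graph, `μ ⇗ λ`. -/
def plancherelUp (mu lam : StrictPartition) : ℝ :=
  lam.dim / ((mu.weight + 1) * mu.dim) * (2 : ℝ) ^ ((mu.length : ℤ) - lam.length + 1)

open Classical in
/-- The up transition probabilities, with parameter `α`, on the Schur graph. -/
def up (α : ℝ) (mu lam : StrictPartition) : ℝ :=
  if Edge mu lam then
    (addedContent mu lam * (addedContent mu lam + 1) + α) / (2 * mu.weight + α)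
      * plancherelUp mu lam
  else 0

/-- The weight `𝕄_n^α(λ)` of the measure with parameter `α` on strict partitions of `n`. -/
def measure (α : ℝ) (n : ℕ) (lam : StrictPartition) : ℝ := growth (up α) empty n lam

/-- Membership of a box in the double: strictly above the diagonal it is the shifted diagram
moved one column to the right, on and below the diagonal it is the reflected shifted diagram. -/
def InDouble (lam : StrictPartition) (b : ℕ × ℕ) : Prop :=
  (b.1 < b.2 ∧ (b.1, b.2 - b.1 - 1) ∈ lam.diagram) ∨
    (b.2 ≤ b.1 ∧ (b.2, b.1 - b.2) ∈ lam.diagram)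

theorem strict_mem (lam : StrictPartition) {i j : ℕ} (h : (i + 1, j) ∈ lam.diagram) :
    (i, j + 1) ∈ lam.diagram := by
  rw [YoungDiagram.mem_iff_lt_rowLen] at *
  have := lam.strict i (i + 1) (by omega) (by omega)
  omega

theorem inDouble_up (lam : StrictPartition) {i j : ℕ} (h : lam.InDouble (i + 1, j)) :
    lam.InDouble (i, j) := by
  rcases h with ⟨h1, h2⟩ | ⟨h1, h2⟩
  · dsimp only at h1 h2
    refine Or.inl ⟨by dsimp only; omega, ?_⟩
    have := lam.strict_mem h2
    rwa [show j - (i + 1) - 1 + 1 = j - i - 1 by omega] at this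
  · dsimp only at h1 h2
    rcases Nat.lt_or_ge i j with hij | hij
    · refine Or.inl ⟨hij, lam.diagram.up_left_mem (i2 := j) (j2 := i + 1 - j) ?_ ?_ h2⟩ <;> omega
    · exact Or.inr ⟨hij, lam.diagram.up_left_mem le_rfl (by dsimp only; omega) h2⟩

theorem inDouble_left (lam : StrictPartition) {i j : ℕ} (h : lam.InDouble (i, j + 1)) :
    lam.InDouble (i, j) := by
  rcases h with ⟨h1, h2⟩ | ⟨h1, h2⟩
  · dsimp only at h1 h2
    rcases Nat.lt_or_ge i j with hij | hij
    · exact Or.inl ⟨hij, lam.diagram.up_left_mem le_rfl (by dsimp only; omega) h2⟩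
    · refine Or.inr ⟨hij, lam.diagram.up_left_mem (i2 := i) (j2 := j + 1 - i - 1) ?_ ?_ h2⟩ <;>
        dsimp only <;> omega
  · dsimp only at h1 h2
    refine Or.inr ⟨by dsimp only; omega, ?_⟩
    have := lam.strict_mem h2
    rwa [show i - (j + 1) + 1 = i - j by omega] at this

theorem inDouble_mono (lam : StrictPartition) (i j a b : ℕ) (h : lam.InDouble (i + a, j + b)) :
    lam.InDouble (i, j) := by
  induction a with
  | zero =>
    induction b with
    | zero => exact h
    | succ b ih => exact ih (lam.inDouble_left h)
  | succ a ih => exact ih (lam.inDouble_up h)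

/-- The doubling `𝒟λ`; see `double_frobenius` for its Frobenius coordinates. -/
def double (lam : StrictPartition) : YoungDiagram where
  cells := lam.diagram.cells.image (fun b => (b.1, b.1 + b.2 + 1)) ∪
    lam.diagram.cells.image (fun b => (b.1 + b.2, b.1))
  isLowerSet := by
    have key : ∀ b : ℕ × ℕ, b ∈ (lam.diagram.cells.image (fun b => (b.1, b.1 + b.2 + 1)) ∪
        lam.diagram.cells.image (fun b => (b.1 + b.2, b.1))) ↔ lam.InDouble b := by
      rintro ⟨i, j⟩
      simp only [Finset.mem_union, Finset.mem_image, YoungDiagram.mem_cells, InDouble,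
        Prod.exists, Prod.mk.injEq]
      refine or_congr ⟨?_, ?_⟩ ⟨?_, ?_⟩
      · rintro ⟨a, b, h, rfl, rfl⟩
        exact ⟨by omega, by rwa [show a + b + 1 - a - 1 = b by omega]⟩
      · rintro ⟨h1, h2⟩
        exact ⟨i, _, h2, rfl, by omega⟩
      · rintro ⟨a, b, h, rfl, rfl⟩
        exact ⟨by omega, by rwa [show a + b - a = b by omega]⟩
      · rintro ⟨h1, h2⟩
        exact ⟨j, _, h2, by omega, rfl⟩
    rintro ⟨i, j⟩ ⟨i', j'⟩ ⟨h1, h2⟩ h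
    dsimp only at h1 h2
    rw [Finset.mem_coe, key] at *
    obtain ⟨a, rfl⟩ := Nat.exists_eq_add_of_le h1
    obtain ⟨b, rfl⟩ := Nat.exists_eq_add_of_le h2
    exact lam.inDouble_mono _ _ _ _ h

theorem mem_double (lam : StrictPartition) (b : ℕ × ℕ) : b ∈ lam.double ↔ lam.InDouble b := by
  obtain ⟨i, j⟩ := b
  rw [← YoungDiagram.mem_cells]
  simp only [double, Finset.mem_union, Finset.mem_image, YoungDiagram.mem_cells, InDouble,
    Prod.exists, Prod.mk.injEq]
  refine or_congr ⟨?_, ?_⟩ ⟨?_, ?_⟩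
  · rintro ⟨a, b, h, rfl, rfl⟩
    exact ⟨by omega, by rwa [show a + b + 1 - a - 1 = b by omega]⟩
  · rintro ⟨h1, h2⟩
    exact ⟨i, _, h2, rfl, by omega⟩
  · rintro ⟨a, b, h, rfl, rfl⟩
    exact ⟨by omega, by rwa [show a + b - a = b by omega]⟩
  · rintro ⟨h1, h2⟩
    exact ⟨j, _, h2, by omega, rfl⟩

/-- The Frobenius coordinates of `𝒟λ` are `(λ₁, …, λ_ℓ | λ₁ - 1, …, λ_ℓ - 1)`: the diagonal has
`ℓ = ℓ(λ)` boxes, and the `i`-th diagonal box has arm length `λ_i` and leg length `λ_i - 1`. -/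
theorem double_frobenius (lam : StrictPartition) (i : ℕ) :
    ((i, i) ∈ lam.double ↔ i < lam.length) ∧
      (i < lam.length → lam.double.rowLen i = i + 1 + lam.part i ∧
        lam.double.colLen i = i + 1 + (lam.part i - 1)) := by
  have h0 : (i, i) ∈ lam.double ↔ i < lam.length := by
    rw [mem_double, length, ← YoungDiagram.mem_iff_lt_colLen]
    simp [InDouble]
  refine ⟨h0, fun hi => ?_⟩
  have hpos : 0 < lam.part i := by
    have : (i, 0) ∈ lam.diagram := YoungDiagram.mem_iff_lt_colLen.2 hi
    exact YoungDiagram.mem_iff_lt_rowLen.1 this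
  have hr : i < lam.double.rowLen i := YoungDiagram.mem_iff_lt_rowLen.1 (h0.2 hi)
  have hc : i < lam.double.colLen i := YoungDiagram.mem_iff_lt_colLen.1 (h0.2 hi)
  have hrow : ∀ k, i + 1 + k < lam.double.rowLen i ↔ k < lam.part i := by
    intro k
    rw [← YoungDiagram.mem_iff_lt_rowLen, mem_double]
    simp only [InDouble, part, ← YoungDiagram.mem_iff_lt_rowLen]
    rw [show i + 1 + k - i - 1 = k by omega]
    constructor
    · rintro (h | h)
      · exact h.2
      · omega
    · exact fun h => Or.inl ⟨by omega, h⟩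
  have hcol : ∀ k, i + k < lam.double.colLen i ↔ k < lam.part i := by
    intro k
    rw [← YoungDiagram.mem_iff_lt_colLen, mem_double]
    simp only [InDouble, part, ← YoungDiagram.mem_iff_lt_rowLen]
    rw [show i + k - i = k by omega]
    constructor
    · rintro (h | h)
      · omega
      · exact h.2
    · exact fun h => Or.inr ⟨by omega, h⟩
  constructor
  · have h1 := hrow (lam.part i)
    have h2 := hrow (lam.part i - 1)
    omega
  · have h1 := hcol (lam.part i)
    have h2 := hcol (lam.part i - 1)
    omega

end StrictPartition

/-! ### Symmetric functions -/

/-- The ring of symmetric functions over `ℂ`, as the polynomial ring `ℂ[p₁, p₂, …]` in the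
power sums; the variable with index `k` is `p_{k+1}`. -/
abbrev SymFun : Type := MvPolynomial ℕ ℂ

/-- The symmetric polynomial in `N` variables given by a symmetric function. -/
def inVars (N : ℕ) : SymFun →ₐ[ℂ] MvPolynomial (Fin N) ℂ :=
  aeval fun k => MvPolynomial.psum (Fin N) ℂ (k + 1)

/-- The specialization `(1, …, 1)` (`z` times) with complex `z`: every power sum goes to `z`. -/
def onesSpec (z : ℂ) : SymFun →ₐ[ℂ] ℂ := aeval fun _ => z

/-- For a natural number `z = N` the specialization sets `N` variables equal to `1`. -/
theorem onesSpec_natCast (N : ℕ) (F : SymFun) :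
    onesSpec N F = aeval (fun _ : Fin N => (1 : ℂ)) (inVars N F) := by
  have : onesSpec N = (aeval (fun _ : Fin N => (1 : ℂ))).comp (inVars N) := by
    apply MvPolynomial.algHom_ext
    intro k
    simp [onesSpec, inVars, MvPolynomial.psum]
  rw [this]; rfl

/-- The complete homogeneous symmetric functions, by `n hₙ = p₁ hₙ₋₁ + p₂ hₙ₋₂ + ⋯ + pₙ h₀`. -/
def complete : ℕ → SymFun
  | 0 => 1
  | n + 1 => ((n + 1 : ℂ)⁻¹) • ∑ k : Fin (n + 1), X (k : ℕ) * complete (n - k)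
termination_by n => n

/-- `hₘ` for an integer `m`, with `hₘ = 0` for `m < 0`. -/
def completeInt (m : ℤ) : SymFun := if m < 0 then 0 else complete m.toNat

/-- `det (h_{ρ_i - i + j})`, of size `N`. -/
def jacobiTrudi (ρ : YoungDiagram) (N : ℕ) : SymFun :=
  (Matrix.of fun i j : Fin N => completeInt ((ρ.rowLen i : ℤ) - (i : ℕ) + (j : ℕ))).det

/-- The Schur function `s_ρ`, through its Jacobi–Trudi determinant of size `ℓ(ρ)`;
`inVars_schur_mul_alternant` shows that in `N ≥ ℓ(ρ)` variables it is the quotient of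
alternants. -/
def schur (ρ : YoungDiagram) : SymFun := jacobiTrudi ρ (ρ.colLen 0)

/-- The alternant `det (x_i ^ (a_j + N - j))`, `1 ≤ i, j ≤ N`. -/
def alternant (N : ℕ) (a : ℕ → ℕ) : MvPolynomial (Fin N) ℂ :=
  (Matrix.of fun i j : Fin N => (X i : MvPolynomial (Fin N) ℂ) ^ (a j + (N - 1 - j))).det

theorem complete_succ (n : ℕ) :
    ((n : SymFun) + 1) * complete (n + 1) =
      ∑ k ∈ Finset.range (n + 1), X k * complete (n - k) := by
  rw [complete, Finset.sum_range (fun k => (X k * complete (n - k) : SymFun))]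
  have : ((n : SymFun) + 1) = MvPolynomial.C ((n : ℂ) + 1) := by simp
  rw [this, ← MvPolynomial.smul_eq_C_mul, smul_smul, mul_inv_cancel₀, one_smul]
  exact_mod_cast Nat.succ_ne_zero n

theorem jacobiTrudi_succ (ρ : YoungDiagram) (N : ℕ) (h : ρ.rowLen N = 0) :
    jacobiTrudi ρ (N + 1) = jacobiTrudi ρ N := by
  rw [jacobiTrudi, Matrix.det_succ_row _ (Fin.last N), Finset.sum_eq_single (Fin.last N)]
  · have : (completeInt 0) = 1 := by simp [completeInt, complete]
    simp only [Matrix.of_apply, Fin.val_last, h, Fin.succAbove_last]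
    rw [show ((0 : ℕ) : ℤ) - N + N = 0 by simp, this, Even.neg_one_pow ⟨N, rfl⟩, one_mul, one_mul]
    rfl
  · intro j _ hj
    have hj' : (j : ℕ) < N := Fin.val_lt_last hj
    have : completeInt ((ρ.rowLen (Fin.last N : Fin (N + 1)) : ℤ) - ((Fin.last N : Fin (N + 1)) : ℕ)
        + (j : ℕ)) = 0 := by
      rw [completeInt, if_pos]
      simp only [Fin.val_last, h]
      omega
    simp [Matrix.of_apply, -Fin.val_last, this]
  · simp

theorem jacobiTrudi_eq_schur (ρ : YoungDiagram) (N : ℕ) (h : ρ.colLen 0 ≤ N) :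
    jacobiTrudi ρ N = schur ρ := by
  induction N, h using Nat.le_induction with
  | base => rfl
  | succ N hN ih =>
    rw [jacobiTrudi_succ ρ N, ih]
    by_contra h0
    have : (N, 0) ∈ ρ := YoungDiagram.mem_iff_lt_rowLen.2 (Nat.pos_of_ne_zero h0)
    have := YoungDiagram.mem_iff_lt_colLen.1 this
    omega

section Alternants

variable {N : ℕ}

/-- The generating series of the complete homogeneous polynomials in `N` variables. -/
def completeSeries (N : ℕ) : PowerSeries (MvPolynomial (Fin N) ℂ) :=
  PowerSeries.mk fun n => inVars N (complete n)

/-- The factor `1 - x_i t`. -/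
def linFactor (i : Fin N) : PowerSeries (MvPolynomial (Fin N) ℂ) :=
  1 - PowerSeries.C (X i) * PowerSeries.X

/-- The geometric series `∑ x_i ^ n t ^ n`. -/
def geomSeries (i : Fin N) : PowerSeries (MvPolynomial (Fin N) ℂ) :=
  PowerSeries.mk fun n => X i ^ n

theorem geomSeries_mul (i : Fin N) : geomSeries i * linFactor i = 1 := by
  ext1 n
  rw [linFactor, mul_sub, mul_one, ← mul_assoc]
  cases n with
  | zero => simp [geomSeries]
  | succ n =>
    rw [map_sub, PowerSeries.coeff_succ_mul_X, PowerSeries.coeff_mul_C, geomSeries,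
      PowerSeries.coeff_mk, PowerSeries.coeff_mk, PowerSeries.coeff_one]
    simp [pow_succ]

theorem deriv_prod_linFactor (s : Finset (Fin N)) :
    PowerSeries.derivative (MvPolynomial (Fin N) ℂ) (∏ i ∈ s, linFactor i) =
      -(∑ i ∈ s, PowerSeries.C (X i) * geomSeries i) * ∏ i ∈ s, linFactor i := by
  induction s using Finset.induction_on with
  | empty => simp
  | insert i s hi ih =>
    have h1 : PowerSeries.derivative (MvPolynomial (Fin N) ℂ) (linFactor i) =
        -PowerSeries.C (X i) := by
      simp [linFactor, Derivation.leibniz, PowerSeries.derivative_C, PowerSeries.derivative_X]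
    rw [Finset.prod_insert hi, Finset.sum_insert hi, Derivation.leibniz, ih, h1, smul_eq_mul,
      smul_eq_mul]
    linear_combination (PowerSeries.C (X i) * ∏ i ∈ s, linFactor i) * geomSeries_mul i

theorem prod_linFactor_mul_complete :
    (∏ i : Fin N, linFactor i) * completeSeries N = 1 := by
  have hH : PowerSeries.derivative (MvPolynomial (Fin N) ℂ) (completeSeries N) =
      (∑ i : Fin N, PowerSeries.C (X i) * geomSeries i) * completeSeries N := by
    ext1 n
    rw [PowerSeries.coeff_derivative, completeSeries, PowerSeries.coeff_mk, PowerSeries.coeff_mul,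
      Finset.Nat.sum_antidiagonal_eq_sum_range_succ_mk]
    have h := congrArg (inVars N) (complete_succ n)
    simp only [map_mul, map_add, map_natCast, map_one, map_sum] at h
    rw [mul_comm, h]
    refine Finset.sum_congr rfl fun k _ => ?_
    simp [inVars, MvPolynomial.psum, geomSeries, pow_succ']
  apply PowerSeries.derivative.ext
  · rw [Derivation.leibniz, hH, deriv_prod_linFactor, smul_eq_mul, smul_eq_mul]
    simp only [Derivation.map_one_eq_zero]
    ring
  · rw [map_mul, map_prod]
    simp [linFactor, completeSeries, complete]

theorem coeff_prod_linFactor (s : Finset (Fin N)) (m : ℕ) (hm : s.card < m) :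
    PowerSeries.coeff m (∏ i ∈ s, linFactor i) = 0 := by
  induction s using Finset.induction_on generalizing m with
  | empty =>
    rw [Finset.prod_empty, PowerSeries.coeff_one, if_neg]
    simp at hm
    omega
  | insert i s hi ih =>
    rw [Finset.card_insert_of_notMem hi] at hm
    obtain ⟨m, rfl⟩ : ∃ k, m = k + 1 := ⟨m - 1, by omega⟩
    rw [Finset.prod_insert hi, linFactor, sub_mul, one_mul, map_sub, ih _ (by omega),
      mul_assoc, PowerSeries.coeff_C_mul, PowerSeries.coeff_succ_X_mul, ih _ (by omega)]
    simp

theorem pow_eq_sum (i : Fin N) (a : ℕ) :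
    (X i : MvPolynomial (Fin N) ℂ) ^ a = ∑ k : Fin N,
      PowerSeries.coeff (N - 1 - k) (∏ j ∈ Finset.univ.erase i, linFactor j) *
        inVars N (completeInt ((a : ℤ) - (N - 1 - k : ℕ))) := by
  set E := ∏ j ∈ Finset.univ.erase i, linFactor j with hE
  have h1 : E * completeSeries N = geomSeries i := by
    have h := prod_linFactor_mul_complete (N := N)
    rw [← Finset.mul_prod_erase _ _ (Finset.mem_univ i), ← hE] at h
    linear_combination (geomSeries i) * h - E * completeSeries N * geomSeries_mul i
  have hN : 0 < N := i.pos
  have hz : ∀ m, N ≤ m → PowerSeries.coeff m E = 0 := by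
    intro m hm
    apply coeff_prod_linFactor
    rw [Finset.card_erase_of_mem (Finset.mem_univ i), Finset.card_univ, Fintype.card_fin]
    omega
  let c : ℕ → MvPolynomial (Fin N) ℂ := fun m =>
    PowerSeries.coeff m E * inVars N (completeInt ((a : ℤ) - (m : ℕ)))
  have h2 : (X i : MvPolynomial (Fin N) ℂ) ^ a = ∑ m ∈ Finset.range (a + 1), c m := by
    have h := congrArg (PowerSeries.coeff a) h1
    rw [geomSeries, PowerSeries.coeff_mk, PowerSeries.coeff_mul,
      Finset.Nat.sum_antidiagonal_eq_sum_range_succ_mk] at h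
    rw [← h]
    refine Finset.sum_congr rfl fun m hm => ?_
    have hm' : m ≤ a := by simpa [Nat.lt_succ_iff] using hm
    simp only [c, completeSeries, PowerSeries.coeff_mk]
    rw [completeInt, if_neg (by omega), show ((a : ℤ) - (m : ℕ)).toNat = a - m by omega]
  have h3 : ∑ m ∈ Finset.range (a + 1), c m = ∑ m ∈ Finset.range (a + 1 + N), c m := by
    apply Finset.sum_subset
    · intro m; simp; omega
    · intro m _ hm
      have hm' : a < m := by simpa [Nat.lt_succ_iff] using hm
      simp only [c]
      rw [completeInt, if_pos (by omega), map_zero, mul_zero]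
  have h4 : ∑ m ∈ Finset.range N, c m = ∑ m ∈ Finset.range (a + 1 + N), c m := by
    apply Finset.sum_subset
    · intro m; simp; omega
    · intro m _ hm
      have hm' : N ≤ m := by simpa using hm
      simp only [c]
      rw [hz m hm', zero_mul]
  rw [h2, h3, ← h4, ← Finset.sum_range_reflect, Finset.sum_range]

theorem alternant_eq (a : ℕ → ℕ) :
    alternant N a = (Matrix.of fun i k : Fin N =>
      PowerSeries.coeff (N - 1 - k) (∏ j ∈ Finset.univ.erase i, linFactor j)).det *
      (Matrix.of fun i j : Fin N =>
        inVars N (completeInt ((a i : ℤ) - (i : ℕ) + (j : ℕ)))).det := by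
  rw [← Matrix.det_transpose (Matrix.of fun i j : Fin N =>
    inVars N (completeInt ((a i : ℤ) - (i : ℕ) + (j : ℕ)))), ← Matrix.det_mul, alternant]
  congr 1
  ext1 i j
  rw [Matrix.of_apply, pow_eq_sum, Matrix.mul_apply]
  refine Finset.sum_congr rfl fun k _ => ?_
  simp only [Matrix.of_apply, Matrix.transpose_apply]
  congr 3
  have := j.2
  have := k.2
  omega

end Alternants

/-- In `N ≥ ℓ(ρ)` variables, `s_ρ = det (x_i ^ (ρ_j + N - j)) / det (x_i ^ (N - j))`. -/
theorem inVars_schur_mul_alternant (ρ : YoungDiagram) (N : ℕ) (h : ρ.colLen 0 ≤ N) :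
    inVars N (schur ρ) * alternant N (fun _ => 0) = alternant N ρ.rowLen := by
  have hmap : ∀ a : ℕ → ℕ, (Matrix.of fun i j : Fin N =>
      inVars N (completeInt ((a i : ℤ) - (i : ℕ) + (j : ℕ)))).det =
      inVars N (Matrix.of fun i j : Fin N =>
        completeInt ((a i : ℤ) - (i : ℕ) + (j : ℕ))).det := by
    intro a
    rw [AlgHom.map_det]
    rfl
  have h1 : (Matrix.of fun i j : Fin N =>
      completeInt (((0 : ℕ) : ℤ) - (i : ℕ) + (j : ℕ))).det = 1 := by
    rw [Matrix.det_of_isUpperTriangular]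
    · apply Finset.prod_eq_one
      intro i _
      simp [completeInt, complete]
    · intro i j hij
      have : (j : ℕ) < i := hij
      rw [Matrix.of_apply, completeInt, if_pos (by omega)]
  rw [alternant_eq, alternant_eq, hmap (fun _ => 0), hmap ρ.rowLen, h1, map_one, mul_one,
    ← jacobiTrudi_eq_schur ρ N h, jacobiTrudi, mul_comm]

/-! ### Parameters -/

/-- `ν(α) = ½ √(1 - 4α)`, which is purely imaginary for `α > 1/4`. -/
def nu (α : ℝ) : ℂ := (1 / 2) * (1 - 4 * (α : ℂ)) ^ (1 / 2 : ℂ)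

/-- `z(α) = ν(α) - ½`. -/
def zParam (α : ℝ) : ℂ := nu α - 1 / 2

/-- `z'(α) = -ν(α) - ½`. -/
def zParam' (α : ℝ) : ℂ := -nu α - 1 / 2

end StrictDoubling

end

/-! Both growth processes have transition probabilities of the form `w(v) dim(v) / (w(u) dim(u))`.
Since `dim(v)` is the sum of `dim(u)` over the predecessors of `v`, their distributions are `w(v)
dim(v)²` (`IsGraded.growth_eq`). This gives closed forms for the two measures (`zMeasure_eq`,
`StrictPartition.measure_eq`) as content products times `f_ρ²` or `g_λ²`. It remains to compare
contents and path counts of `λ` and of `ρ = 𝒟λ`.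

Contents: a box of content `c` in the shifted diagram produces two boxes of the double, of contents
`c + 1` and `-c`. As `z = ν - 1/2` satisfies `z(z + 1) = -α`, one has `(z + c + 1)(z - c) = -(c(c +
1) + α)`, and likewise for `z' = -1 - z`. So the content product of `𝒟λ` at `z` is `(-1)ⁿ P`, with
`P = ∏ (c(c + 1) + α)`, and the one for the `z`-measure is `P²`.

Path counts: with `T = f_{𝒟λ} / (2n)!`, the identity `T = 2^{-ℓ} (g_λ / n!)²`
(`StrictPartition.tabDet_double`) makes `f_{𝒟λ}` play the role of `g_λ²`. It follows from product
formulas for both numbers: `f_ρ / |ρ|!` is `det (1 / (ρ_i - i + j)!)`, hence a Vandermonde product,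
and `g_λ / n!` is Schur's product of `(λ_i - λ_j) / (λ_i + λ_j)` over `∏ λ_i!`. Each is proved by
checking the recursion over predecessors.

Finally `s_ρ(1, …, 1) = ∏ (z + c) · f_ρ / |ρ|!` (`onesSpec_schur`). Hence the Schur value is `(-1)ⁿ
P T`, the strict measure is `n! / (α/2)_n · P T`, and the `z`-measure is `(2n)! / (α)_{2n} · (P
T)²`; both claims can be read off because `P T > 0`. -/

noncomputable section

namespace StrictDoubling

/-! ### Path counting and growth on graded graphs -/

/-- A graph graded by `rank`, with a unique vertex of rank zero and finitely many edges into
each vertex. -/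
structure IsGraded {V : Type} (E : V → V → Prop) (root : V) (rank : V → ℕ) : Prop where
  rank_root : rank root = 0
  eq_root : ∀ v, rank v = 0 → v = root
  rank_edge : ∀ u v, E u v → rank v = rank u + 1
  finite_pred : ∀ v, {u | E u v}.Finite

namespace IsGraded

variable {V : Type} {E : V → V → Prop} {root : V} {rank : V → ℕ}

/-- The finite set of starting points of the edges into `v`. -/
def pred (h : IsGraded E root rank) (v : V) : Finset V := (h.finite_pred v).toFinset

theorem mem_pred (h : IsGraded E root rank) {u v : V} : u ∈ h.pred v ↔ E u v := by
  simp [pred]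

theorem unique_path (h : IsGraded E root rank) (p : GraphPath E root root) :
    p = GraphPath.nil := by
  cases p with
  | nil => rfl
  | cons p hE =>
    have := h.rank_edge _ _ hE
    rw [h.rank_root] at this
    omega

theorem numPaths_root (h : IsGraded E root rank) : numPaths E root root = 1 :=
  Nat.card_eq_one_iff_unique.2 ⟨⟨fun p q => by rw [h.unique_path p, h.unique_path q]⟩, ⟨.nil⟩⟩

/-- Paths to a vertex other than the root, sorted by their last edge. -/
theorem bijective_cons {v : V} (hv : v ≠ root) :
    Function.Bijective (fun x : Σ u : {u // E u v}, GraphPath E root u.1 =>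
      GraphPath.cons x.2 x.1.2) := by
  constructor
  · rintro ⟨⟨u, hu⟩, p⟩ ⟨⟨u', hu'⟩, p'⟩ hp
    dsimp only at hp
    cases hp
    rfl
  · intro p
    cases p with
    | nil => exact absurd rfl hv
    | cons p hE => exact ⟨⟨⟨_, hE⟩, p⟩, rfl⟩

theorem finite_path (h : IsGraded E root rank) (v : V) : Finite (GraphPath E root v) := by
  induction hn : rank v generalizing v with
  | zero =>
    obtain rfl := h.eq_root v hn
    have : Subsingleton (GraphPath E v v) :=
      ⟨fun p q => by rw [h.unique_path p, h.unique_path q]⟩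
    infer_instance
  | succ n ih =>
    have hv : v ≠ root := by
      rintro rfl
      rw [h.rank_root] at hn
      omega
    have : Finite {u // E u v} := (h.finite_pred v).to_subtype
    have (u : {u // E u v}) : Finite (GraphPath E root u.1) := by
      have := h.rank_edge _ _ u.2
      exact ih _ (by omega)
    exact Finite.of_surjective _ (bijective_cons hv).2

theorem numPaths_eq_sum (h : IsGraded E root rank) {v : V} (hv : v ≠ root) :
    numPaths E root v = ∑ u ∈ h.pred v, numPaths E root u := by
  have : Fintype {u // E u v} := (h.finite_pred v).fintype
  have (u : V) := h.finite_path u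
  rw [numPaths, ← Nat.card_congr (Equiv.ofBijective _ (bijective_cons hv)), Nat.card_sigma,
    Finset.sum_subtype _ (fun u => h.mem_pred)]
  rfl

/-- A solution of the recursion for `numPaths / rank!` computes the number of paths. -/
theorem numPaths_eq_factorial_mul (h : IsGraded E root rank) (P : V → Prop)
    (hP : ∀ u v, E u v → P v → P u) (Φ : V → ℝ) (hΦ0 : Φ root = 1)
    (hΦ : ∀ v, P v → v ≠ root → rank v * Φ v = ∑ u ∈ h.pred v, Φ u) (v : V) (hv : P v) :
    (numPaths E root v : ℝ) = (rank v)! * Φ v := by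
  induction hn : rank v generalizing v with
  | zero =>
    obtain rfl := h.eq_root v hn
    simp [h.numPaths_root, hΦ0]
  | succ n ih =>
    have hr : v ≠ root := by
      rintro rfl
      rw [h.rank_root] at hn
      omega
    have h1 : ∀ u ∈ h.pred v, (numPaths E root u : ℝ) = n ! * Φ u := by
      intro u hu
      rw [h.mem_pred] at hu
      have := h.rank_edge _ _ hu
      exact ih u (hP u v hu hv) (by omega)
    rw [h.numPaths_eq_sum hr, Nat.cast_sum, Finset.sum_congr rfl h1, ← Finset.mul_sum,
      ← hΦ v hv hr, hn, Nat.factorial_succ]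
    push_cast
    ring

/-- The distribution of a growth process whose transition probabilities are proportional to
`w v * dim v / (w u * dim u)`. -/
theorem growth_eq (h : IsGraded E root rank) {𝕜 : Type} [Field 𝕜] {p : V → V → 𝕜} {w : V → 𝕜}
    (hw : w root = 1) (hp0 : ∀ u v, ¬ E u v → p u v = 0)
    (hp : ∀ u v, E u v → w u * numPaths E root u * p u v = w v * numPaths E root v) (v : V) :
    growth p root (rank v) v = w v * numPaths E root v ^ 2 := by
  induction hn : rank v generalizing v with
  | zero =>
    obtain rfl := h.eq_root v hn
    simp [growth, h.numPaths_root, hw]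
  | succ n ih =>
    have hr : v ≠ root := by
      rintro rfl
      rw [h.rank_root] at hn
      omega
    rw [growth, finsum_eq_sum_of_support_subset (s := h.pred v)]
    -- By `hp` the predecessor `u` contributes `w v * dim v * dim u`, and the `dim u` add up to the
    -- second factor `dim v`. The form of `hp` avoids dividing by `w u`, which can vanish for
    -- general `z`-measures.
    · have h1 : ∀ u ∈ h.pred v, growth p root n u * p u v =
          w v * numPaths E root v * numPaths E root u := by
        intro u hu
        rw [h.mem_pred] at hu
        have := h.rank_edge _ _ hu
        rw [ih u (by omega), ← hp u v hu]
        ring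
      rw [Finset.sum_congr rfl h1, ← Finset.mul_sum, ← Nat.cast_sum, ← h.numPaths_eq_sum hr]
      ring
    · intro u hu
      by_contra hE
      rw [Finset.mem_coe, h.mem_pred] at hE
      exact hu (by simp [hp0 u v hE])

end IsGraded

/-! ### Removing a box from a Young diagram -/

theorem rowLen_eq_zero {ρ : YoungDiagram} {i : ℕ} (h : ρ.colLen 0 ≤ i) : ρ.rowLen i = 0 := by
  by_contra h0
  have := YoungDiagram.mem_iff_lt_colLen.1
    (YoungDiagram.mem_iff_lt_rowLen.2 (Nat.pos_of_ne_zero h0))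
  omega

theorem rowLen_bot (i : ℕ) : (⊥ : YoungDiagram).rowLen i = 0 := by
  by_contra h
  exact YoungDiagram.notMem_bot _ (YoungDiagram.mem_iff_lt_rowLen.2 (Nat.pos_of_ne_zero h))

theorem colLen_bot (j : ℕ) : (⊥ : YoungDiagram).colLen j = 0 := by
  by_contra h
  exact YoungDiagram.notMem_bot _ (YoungDiagram.mem_iff_lt_colLen.2 (Nat.pos_of_ne_zero h))

theorem ext_rowLen {ρ σ : YoungDiagram} (h : ∀ i, ρ.rowLen i = σ.rowLen i) : ρ = σ := by
  ext ⟨i, j⟩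
  simp only [YoungDiagram.mem_cells, YoungDiagram.mem_iff_lt_rowLen, h]

theorem prod_cells {M : Type*} [CommMonoid M] (ρ : YoungDiagram) {N : ℕ} (h : ρ.colLen 0 ≤ N)
    (f : ℕ × ℕ → M) :
    ∏ b ∈ ρ.cells, f b = ∏ i ∈ Finset.range N, ∏ j ∈ Finset.range (ρ.rowLen i), f (i, j) := by
  apply Finset.prod_finset_product
  rintro ⟨i, j⟩
  simp only [YoungDiagram.mem_cells, YoungDiagram.mem_iff_lt_rowLen, Finset.mem_range]
  refine ⟨fun hj => ⟨?_, hj⟩, fun hj => hj.2⟩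
  by_contra hi
  have := rowLen_eq_zero (i := i) (h.trans (by omega))
  omega

theorem card_eq_sum (ρ : YoungDiagram) {N : ℕ} (h : ρ.colLen 0 ≤ N) :
    ρ.card = ∑ i ∈ Finset.range N, ρ.rowLen i := by
  have := congrArg Multiplicative.toAdd
    (prod_cells ρ h (fun _ => Multiplicative.ofAdd 1))
  simpa [YoungDiagram.card, toAdd_prod] using this

/-- The diagram obtained by removing the last box of row `i`, and everything not above it or to
the left of it. -/
def truncate (ρ : YoungDiagram) (i : ℕ) : YoungDiagram where
  cells := {b ∈ ρ.cells | ¬ (i ≤ b.1 ∧ ρ.rowLen i - 1 ≤ b.2)}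
  isLowerSet := by
    rintro ⟨a, b⟩ ⟨c, d⟩ ⟨h1, h2⟩ h
    dsimp only at h1 h2
    simp only [Finset.coe_filter, YoungDiagram.mem_cells, Set.mem_ofPred_eq] at h ⊢
    exact ⟨ρ.up_left_mem h1 h2 h.1, by omega⟩

theorem mem_truncate {ρ : YoungDiagram} {i : ℕ} {b : ℕ × ℕ} :
    b ∈ truncate ρ i ↔ b ∈ ρ ∧ ¬ (i ≤ b.1 ∧ ρ.rowLen i - 1 ≤ b.2) := by
  rw [← YoungDiagram.mem_cells, truncate, Finset.mem_filter, YoungDiagram.mem_cells]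

theorem rowLen_truncate {ρ : YoungDiagram} {i : ℕ} (h : ρ.rowLen (i + 1) < ρ.rowLen i) :
    (truncate ρ i).rowLen = Function.update ρ.rowLen i (ρ.rowLen i - 1) := by
  funext k
  refine Nat.le_antisymm ?_ ?_ <;> rw [← forall_lt_iff_le] <;> intro j hj
  all_goals
    rw [← YoungDiagram.mem_iff_lt_rowLen, mem_truncate, YoungDiagram.mem_iff_lt_rowLen] at *
    have h1 := ρ.rowLen_anti k i
    have h2 := ρ.rowLen_anti (i + 1) k
    rcases eq_or_ne k i with rfl | hk
    · simp only [Function.update_self] at *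
      omega
    · simp only [Function.update_of_ne hk] at *
      omega

theorem cells_truncate {ρ : YoungDiagram} {i : ℕ} (h : ρ.rowLen (i + 1) < ρ.rowLen i) :
    ρ.cells = insert (i, ρ.rowLen i - 1) (truncate ρ i).cells := by
  ext ⟨k, j⟩
  simp only [Finset.mem_insert, YoungDiagram.mem_cells, YoungDiagram.mem_iff_lt_rowLen,
    rowLen_truncate h, Prod.mk.injEq]
  have h1 := ρ.rowLen_anti k i
  have h2 := ρ.rowLen_anti (i + 1) k
  rcases eq_or_ne k i with rfl | hk
  · rw [Function.update_self]
    omega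
  · rw [Function.update_of_ne hk]
    omega

theorem notMem_truncate (ρ : YoungDiagram) (i : ℕ) :
    (i, ρ.rowLen i - 1) ∉ (truncate ρ i).cells := by
  rw [YoungDiagram.mem_cells, mem_truncate]
  simp

theorem youngEdge_truncate {ρ : YoungDiagram} {i : ℕ} (h : ρ.rowLen (i + 1) < ρ.rowLen i) :
    YoungEdge (truncate ρ i) ρ := by
  have := cells_truncate h
  refine ⟨this ▸ Finset.subset_insert _ _, ?_⟩
  rw [YoungDiagram.card, this, Finset.card_insert_of_notMem (notMem_truncate ρ i)]

theorem exists_insert {σ ρ : YoungDiagram} (h : YoungEdge σ ρ) :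
    ∃ b, b ∉ σ.cells ∧ ρ.cells = insert b σ.cells := by
  obtain ⟨b, hb⟩ := Finset.card_eq_one.1
    (show (ρ.cells \ σ.cells).card = 1 by
      rw [Finset.card_sdiff_of_subset h.1]
      have := h.2
      simp only [YoungDiagram.card] at this
      omega)
  refine ⟨b, fun hbσ => ?_, ?_⟩
  · have : b ∈ ρ.cells \ σ.cells := by simp [hb]
    exact (Finset.mem_sdiff.1 this).2 hbσ
  · rw [Finset.insert_eq, ← hb, Finset.sdiff_union_of_subset h.1]

theorem youngEdge_iff {σ ρ : YoungDiagram} :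
    YoungEdge σ ρ ↔ ∃ i, ρ.rowLen (i + 1) < ρ.rowLen i ∧ σ = truncate ρ i := by
  constructor
  · intro h
    obtain ⟨⟨i, j⟩, hb, hρ⟩ := exists_insert h
    have key : ∀ k l, l < ρ.rowLen k ↔ (k = i ∧ l = j) ∨ l < σ.rowLen k := by
      intro k l
      rw [← YoungDiagram.mem_iff_lt_rowLen, ← YoungDiagram.mem_iff_lt_rowLen,
        ← YoungDiagram.mem_cells, hρ, Finset.mem_insert, Prod.mk.injEq, YoungDiagram.mem_cells]
    rw [YoungDiagram.mem_cells, YoungDiagram.mem_iff_lt_rowLen] at hb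
    -- The first two instances force `j = σ_i`, `h5` gives `ρ_i = j + 1`, and `h3` with `h4` gives
    -- `ρ_{i+1} ≤ j`; so row `i` is a corner of `ρ`.
    have h1 := key i j
    have h2 := key i (σ.rowLen i)
    have h3 := key (i + 1) j
    have h4 := σ.rowLen_anti i (i + 1)
    have h5 := key i (j + 1)
    refine ⟨i, by omega, ?_⟩
    apply ext_rowLen
    intro k
    rw [rowLen_truncate (by omega)]
    rcases eq_or_ne k i with rfl | hk
    · rw [Function.update_self]
      omega
    · rw [Function.update_of_ne hk]
      have h6 := key k (ρ.rowLen k)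
      have h7 := key k (σ.rowLen k)
      omega
  · rintro ⟨i, h, rfl⟩
    exact youngEdge_truncate h

theorem colLen_mono {σ ρ : YoungDiagram} (h : σ.cells ⊆ ρ.cells) : σ.colLen 0 ≤ ρ.colLen 0 := by
  rw [← forall_lt_iff_le]
  intro i hi
  rw [← YoungDiagram.mem_iff_lt_colLen, ← YoungDiagram.mem_cells] at *
  exact h hi

theorem youngDiagram_isGraded : IsGraded YoungEdge ⊥ YoungDiagram.card where
  rank_root := rfl
  eq_root v hv := by
    ext b
    rw [Finset.card_eq_zero.1 hv]
    simp
  rank_edge u v h := h.2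
  finite_pred v := by
    refine ((Finset.finite_toSet (Finset.range (v.colLen 0))).image (truncate v)).subset ?_
    rintro u hu
    obtain ⟨i, hi, rfl⟩ := youngEdge_iff.1 hu
    refine ⟨i, ?_, rfl⟩
    rw [Finset.mem_coe, Finset.mem_range]
    by_contra h
    have := rowLen_eq_zero (i := i) (ρ := v) (by omega)
    omega

theorem truncate_injOn (ρ : YoungDiagram) :
    Set.InjOn (truncate ρ) {i | ρ.rowLen (i + 1) < ρ.rowLen i} := by
  intro i hi j hj h
  by_contra hij
  have := congrFun (congrArg YoungDiagram.rowLen h) i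
  rw [rowLen_truncate hi, rowLen_truncate hj, Function.update_self,
    Function.update_of_ne hij] at this
  have hi' : ρ.rowLen (i + 1) < ρ.rowLen i := hi
  omega

theorem sum_pred_young (ρ : YoungDiagram) {N : ℕ} (h : ρ.colLen 0 ≤ N) (Φ : YoungDiagram → ℝ) :
    ∑ σ ∈ youngDiagram_isGraded.pred ρ, Φ σ =
      ∑ i ∈ Finset.range N, if ρ.rowLen (i + 1) < ρ.rowLen i then Φ (truncate ρ i) else 0 := by
  rw [← Finset.sum_filter]
  symm
  apply Finset.sum_nbij (truncate ρ)
  · intro i hi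
    rw [IsGraded.mem_pred]
    exact youngEdge_truncate (Finset.mem_filter.1 hi).2
  · exact (truncate_injOn ρ).mono fun i hi => (Finset.mem_filter.1 hi).2
  · intro σ hσ
    rw [Finset.mem_coe, IsGraded.mem_pred] at hσ
    obtain ⟨i, hi, rfl⟩ := youngEdge_iff.1 hσ
    refine ⟨i, ?_, rfl⟩
    rw [Finset.mem_coe, Finset.mem_filter, Finset.mem_range]
    refine ⟨?_, hi⟩
    by_contra hN
    have := rowLen_eq_zero (i := i) (ρ := ρ) (by omega)
    omega
  · intros; rfl

/-! ### The number of standard tableaux -/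

/-- `1 / k!`, extended by zero to negative integers. -/
def invFact (k : ℤ) : ℝ := if k < 0 then 0 else ((k.toNat)! : ℝ)⁻¹

theorem invFact_sub_one (k : ℤ) : invFact (k - 1) = k * invFact k := by
  rcases lt_trichotomy k 0 with h | rfl | h
  · rw [invFact, invFact, if_pos (by omega), if_pos h, mul_zero]
  · simp [invFact]
  · obtain ⟨m, rfl⟩ : ∃ m : ℕ, k = m + 1 := ⟨(k - 1).toNat, by omega⟩
    rw [invFact, invFact, if_neg (by omega), if_neg (by omega),
      show ((m : ℤ) + 1 - 1).toNat = m by omega, show ((m : ℤ) + 1).toNat = m + 1 by omega,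
      Nat.factorial_succ]
    push_cast
    have : (m : ℝ) + 1 ≠ 0 := by positivity
    field_simp

/-- Multiplying the entries of one row at a time by `a i + b j` acts on the determinant as a
derivation. -/
theorem sum_det_updateRow_mul {N : ℕ} (M : Matrix (Fin N) (Fin N) ℝ) (a b : Fin N → ℝ) :
    ∑ i, (M.updateRow i fun j => (a i + b j) * M i j).det = (∑ i, (a i + b i)) * M.det := by
  have h1 : ∀ i, (M.updateRow i fun j => (a i + b j) * M i j).det =
      ∑ σ : Equiv.Perm (Fin N), (a i + b (σ i)) * (Equiv.Perm.sign σ • ∏ k, M k (σ k)) := by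
    intro i
    rw [← Matrix.det_transpose, Matrix.det_apply]
    refine Finset.sum_congr rfl fun σ _ => ?_
    rw [mul_smul_comm]
    congr 1
    rw [← Finset.mul_prod_erase _ _ (Finset.mem_univ i),
      ← Finset.mul_prod_erase _ (fun k => M k (σ k)) (Finset.mem_univ i), ← mul_assoc]
    congr 1
    · simp
    · refine Finset.prod_congr rfl fun k hk => ?_
      rw [Matrix.transpose_apply, Matrix.updateRow_ne (Finset.ne_of_mem_erase hk)]
  simp_rw [h1]
  rw [Finset.sum_comm, ← Matrix.det_transpose, Matrix.det_apply, Finset.mul_sum]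
  -- The total weight picked up by the term of `σ` is `∑ (a i + b (σ i))`, which does not depend on
  -- `σ`.
  refine Finset.sum_congr rfl fun σ _ => ?_
  rw [← Finset.sum_mul, Finset.sum_add_distrib, Finset.sum_add_distrib, Equiv.sum_comp σ b]
  rfl

/-- The matrix `1 / (r_i + j)!`. -/
def factMatrix {N : ℕ} (r : Fin N → ℤ) : Matrix (Fin N) (Fin N) ℝ :=
  Matrix.of fun i j => invFact (r i + (j : ℕ))

/-- Since `1 / (k - 1)! = k / k!`, also for `k ≤ 0`, lowering `r i` multiplies the entry `(i, j)` by
`r i + j`, a row weight plus a column weight. -/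
theorem sum_det_factMatrix {N : ℕ} (r : Fin N → ℤ) :
    ∑ i, (factMatrix (Function.update r i (r i - 1))).det =
      (∑ i, (r i + (i : ℕ) : ℝ)) * (factMatrix r).det := by
  rw [← sum_det_updateRow_mul (factMatrix r) (fun i => r i) (fun i => (i : ℕ))]
  refine Finset.sum_congr rfl fun i _ => ?_
  congr 1
  ext k j
  rcases eq_or_ne k i with rfl | hk
  · simp only [factMatrix, Matrix.of_apply, Function.update_self, Matrix.updateRow_self]
    rw [show r k - 1 + (j : ℕ) = r k + (j : ℕ) - 1 by ring, invFact_sub_one]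
    push_cast
    rfl
  · simp [factMatrix, Matrix.of_apply, Function.update_of_ne hk, Matrix.updateRow_ne hk]

/-- The shifted rows `ρ_i - i` of a diagram. -/
def shiftRow (N : ℕ) (ρ : YoungDiagram) (i : Fin N) : ℤ := (ρ.rowLen i : ℤ) - (i : ℕ)

/-- The number of standard tableaux of shape `ρ` divided by `|ρ|!`, as the determinant
`det (1 / (ρ_i - i + j)!)`. -/
def tabDet (N : ℕ) (ρ : YoungDiagram) : ℝ := (factMatrix (shiftRow N ρ)).det

theorem tabDet_bot (N : ℕ) : tabDet N ⊥ = 1 := by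
  rw [tabDet, Matrix.det_of_isUpperTriangular]
  · apply Finset.prod_eq_one
    intro i _
    simp [factMatrix, shiftRow, rowLen_bot, invFact]
  · intro i j hij
    have : (j : ℕ) < i := hij
    rw [factMatrix, Matrix.of_apply, shiftRow, rowLen_bot, invFact, if_pos (by omega)]

theorem tabDet_recursion {N : ℕ} {ρ : YoungDiagram} (h : ρ.colLen 0 ≤ N) :
    ρ.card * tabDet N ρ = ∑ σ ∈ youngDiagram_isGraded.pred ρ, tabDet N σ := by
  rw [sum_pred_young ρ h, card_eq_sum ρ h, Finset.sum_range, Finset.sum_range]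
  have h1 := sum_det_factMatrix (shiftRow N ρ)
  have h2 : ∀ i : Fin N, ((shiftRow N ρ i : ℝ) + (i : ℕ)) = ρ.rowLen i := by
    intro i
    rw [shiftRow]
    push_cast
    ring
  simp_rw [h2] at h1
  rw [tabDet]
  push_cast
  rw [← h1]
  refine Finset.sum_congr rfl fun i _ => ?_
  split_ifs with hi
  · rw [tabDet]
    congr 2
    funext k
    change _ = ((truncate ρ i).rowLen k : ℤ) - (k : ℕ)
    rw [rowLen_truncate hi]
    rcases eq_or_ne k i with rfl | hk
    · rw [Function.update_self, Function.update_self, shiftRow]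
      omega
    · rw [Function.update_of_ne hk, Function.update_of_ne (by simpa [Fin.ext_iff] using hk),
        shiftRow]
  -- If row `i` is not a corner, lowering it makes rows `i` and `i + 1` of the matrix equal or, when
  -- `i` is the last index, makes row `i` vanish. So only genuine predecessors contribute.
  · have hle := ρ.rowLen_anti i (i + 1) (by omega)
    rcases Nat.lt_or_ge (i + 1) N with hN | hN
    · refine Matrix.det_zero_of_row_eq (i := i) (j := ⟨i + 1, hN⟩) (by simp [Fin.ext_iff]) ?_
      funext j
      rw [factMatrix, Matrix.of_apply, Matrix.of_apply, Function.update_self,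
        Function.update_of_ne (by simp [Fin.ext_iff]), shiftRow, shiftRow]
      congr 1
      push_cast
      have : ρ.rowLen (i + 1) = ρ.rowLen i := by omega
      rw [this]
      ring
    · apply Matrix.det_eq_zero_of_row_eq_zero i
      intro j
      have := rowLen_eq_zero (i := i + 1) (h.trans hN)
      have := j.2
      rw [factMatrix, Matrix.of_apply, Function.update_self, shiftRow, invFact, if_pos (by omega)]

/-- The recursion for the determinant of size `N` is available for diagrams with at most `N` rows, a
class closed under removing boxes. -/
theorem youngDim_eq {N : ℕ} {ρ : YoungDiagram} (h : ρ.colLen 0 ≤ N) :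
    (youngDim ρ : ℝ) = ρ.card ! * tabDet N ρ :=
  youngDiagram_isGraded.numPaths_eq_factorial_mul (fun ρ => ρ.colLen 0 ≤ N)
    (fun _ _ hE hv => (colLen_mono hE.1).trans hv) _ (tabDet_bot N)
    (fun _ hv _ => tabDet_recursion hv) ρ h

/-! ### Vandermonde evaluation -/

/-- The shifted rows `ρ_i + N - 1 - i`, in increasing order. -/
def node (N : ℕ) (ρ : YoungDiagram) (i : Fin N) : ℕ := ρ.rowLen (Fin.rev i) + i

theorem node_strictMono (N : ℕ) (ρ : YoungDiagram) : StrictMono (node N ρ) := by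
  intro i j hij
  have h1 : (i : ℕ) < j := hij
  have := ρ.rowLen_anti (Fin.rev j) (Fin.rev i) (by simp only [Fin.val_rev]; omega)
  rw [node, node]
  omega

/-- Rows and columns are reversed simultaneously, so no sign appears. -/
theorem det_eq_det_node {R : Type*} [CommRing R] (N : ℕ) (ρ : YoungDiagram) (f : ℤ → R) :
    (Matrix.of fun i j : Fin N => f (shiftRow N ρ i + (j : ℕ))).det =
      (Matrix.of fun i j : Fin N => f ((node N ρ i : ℤ) - (j : ℕ))).det := by
  rw [← Matrix.det_submatrix_equiv_self Fin.revPerm]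
  congr 1
  ext i j
  simp only [Matrix.submatrix_apply, Matrix.of_apply, shiftRow, node, Fin.revPerm_apply]
  congr 1
  have := i.2
  have := j.2
  simp only [Fin.val_rev]
  omega

theorem invFact_sub (x j : ℕ) :
    invFact ((x : ℤ) - j) = ((x)! : ℝ)⁻¹ * (descPochhammer ℝ j).eval (x : ℝ) := by
  rw [descPochhammer_eval_eq_descFactorial, invFact]
  split_ifs with h
  · rw [Nat.descFactorial_eq_zero_iff_lt.2 (by omega)]
    simp
  · rw [show ((x : ℤ) - j).toNat = x - j by omega,
      ← Nat.factorial_mul_descFactorial (show j ≤ x by omega)]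
    have h1 : ((x - j)! : ℝ) ≠ 0 := by positivity
    have h2 : (x.descFactorial j : ℝ) ≠ 0 := by
      exact_mod_cast (Nat.descFactorial_pos.2 (by omega)).ne'
    push_cast
    field_simp

/-- After extracting `1 / x!` from the row with node `x`, the entries are falling factorials of `x`,
monic of degree equal to the column index. -/
theorem tabDet_eq_vandermonde (N : ℕ) (ρ : YoungDiagram) :
    tabDet N ρ = (∏ i, ((node N ρ i)! : ℝ)⁻¹) *
      (Matrix.vandermonde fun i => (node N ρ i : ℝ)).det := by
  rw [tabDet, factMatrix, det_eq_det_node]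
  simp_rw [invFact_sub]
  rw [Matrix.det_eval_matrixOfPolynomials_eq_det_vandermonde _ (fun j => descPochhammer ℝ j)
    (fun j => descPochhammer_natDegree _ _) (fun j => monic_descPochhammer _ _),
    ← Matrix.det_mul_column]
  rfl

theorem tabDet_pos (N : ℕ) (ρ : YoungDiagram) : 0 < tabDet N ρ := by
  rw [tabDet_eq_vandermonde, Matrix.det_vandermonde]
  apply mul_pos
  · exact Finset.prod_pos fun i _ => by positivity
  · refine Finset.prod_pos fun i _ => Finset.prod_pos fun j hj => ?_
    have := node_strictMono N ρ (Finset.mem_Ioi.1 hj)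
    rw [sub_pos]
    exact_mod_cast this

/-! ### The specialization of Schur functions at `(1, …, 1)` -/

/-- This is what the recursion for the complete functions becomes when every power sum equals `z`.
-/
theorem sum_ascPochhammer_div_factorial (z : ℂ) (n : ℕ) :
    z * ∑ k ∈ Finset.range (n + 1), (ascPochhammer ℂ k).eval z / (k ! : ℂ) =
      (n + 1) * ((ascPochhammer ℂ (n + 1)).eval z / ((n + 1)! : ℂ)) := by
  induction n with
  | zero => simp
  | succ n ih =>
    rw [Finset.sum_range_succ, mul_add, ih, ascPochhammer_succ_eval (n + 1),
      Nat.factorial_succ (n + 1)]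
    have h1 : ((n + 1)! : ℂ) ≠ 0 := by exact_mod_cast (Nat.factorial_pos _).ne'
    have h2 : (n : ℂ) + 1 + 1 ≠ 0 := by exact_mod_cast (Nat.succ_ne_zero (n + 1))
    push_cast
    field_simp
    ring

theorem onesSpec_complete (z : ℂ) (n : ℕ) :
    onesSpec z (complete n) = (ascPochhammer ℂ n).eval z / (n ! : ℂ) := by
  induction n using Nat.strong_induction_on with
  | _ n ih =>
    cases n with
    | zero => simp [complete]
    | succ n =>
      have h := congrArg (onesSpec z) (complete_succ n)
      simp only [map_mul, map_add, map_natCast, map_one, map_sum] at h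
      have hX (k : ℕ) : onesSpec z (X k) = z := by simp [onesSpec]
      simp_rw [hX] at h
      rw [← Finset.mul_sum, Finset.sum_congr rfl
        (fun k _ => ih (n - k) (by omega) : ∀ k ∈ Finset.range (n + 1), _ =
          (ascPochhammer ℂ (n - k)).eval z / ((n - k)! : ℂ))] at h
      have h2 := Finset.sum_range_reflect
        (fun k => (ascPochhammer ℂ k).eval z / (k ! : ℂ)) (n + 1)
      simp only [Nat.add_sub_cancel] at h2
      rw [h2, sum_ascPochhammer_div_factorial] at h
      exact mul_left_cancel₀ (by exact_mod_cast Nat.succ_ne_zero n) h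

/-- Evaluating polynomials of degree less than `N` at `N` points gives a multiple of the
Vandermonde determinant. -/
theorem exists_det_eval_eq {R : Type*} [CommRing R] {N : ℕ} (p : Fin N → Polynomial R)
    (hp : ∀ j, (p j).natDegree < N) :
    ∃ D : R, ∀ v : Fin N → R,
      (Matrix.of fun i j => (p j).eval (v i)).det = (Matrix.vandermonde v).det * D := by
  refine ⟨(Matrix.of fun k j : Fin N => (p j).coeff k).det, fun v => ?_⟩
  rw [← Matrix.det_mul]
  congr 1
  ext i j
  rw [Matrix.of_apply, Matrix.mul_apply, Polynomial.eval_eq_sum_range' (hp j), Finset.sum_range]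
  refine Finset.sum_congr rfl fun k _ => ?_
  rw [Matrix.vandermonde_apply, Matrix.of_apply, mul_comm]

theorem Gamma_add_natCast {w : ℂ} (hw : ∀ m : ℤ, w ≠ m) (n : ℕ) :
    Complex.Gamma (w + n) = (ascPochhammer ℂ n).eval w * Complex.Gamma w := by
  have h : ∀ k : ℕ, w ≠ -k := fun k => by simpa using hw (-k)
  rw [← Complex.Gamma_add_nat_div_Gamma_eq w h, div_mul_cancel₀ _ (Complex.Gamma_ne_zero h)]

theorem ne_intCast_add {z : ℂ} (hz : ∀ m : ℤ, z ≠ m) (k m : ℤ) : z + k ≠ m := by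
  intro h
  apply hz (m - k)
  push_cast
  linear_combination h

/-- Writing `(z)_{x-j} / (x-j)!` with Gamma functions splits it into a factor depending on the row
only and a polynomial in `x` of degree at most `N - 1`. Non-integrality of `z` keeps all Gamma
values finite and nonzero. -/
theorem onesSpec_completeInt_sub {z : ℂ} (hz : ∀ m : ℤ, z ≠ m) {N j : ℕ} (hj : j < N) (x : ℕ) :
    onesSpec z (completeInt ((x : ℤ) - j)) =
      (Complex.Gamma (z + ((x - N + 1 : ℤ) : ℂ)) / Complex.Gamma z * (x ! : ℂ)⁻¹) *
        (descPochhammer ℂ j * (ascPochhammer ℂ (N - 1 - j)).comp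
          (Polynomial.X + Polynomial.C (z - N + 1))).eval (x : ℂ) := by
  rw [Polynomial.eval_mul, descPochhammer_eval_eq_descFactorial, completeInt]
  split_ifs with h
  · rw [Nat.descFactorial_eq_zero_iff_lt.2 (by omega)]
    simp
  · rw [show ((x : ℤ) - j).toNat = x - j by omega, onesSpec_complete]
    have hΓ : Complex.Gamma z ≠ 0 := Complex.Gamma_ne_zero fun k => by simpa using hz (-k)
    have h1 := Gamma_add_natCast hz (x - j)
    have h2 := Gamma_add_natCast (ne_intCast_add hz (x - N + 1)) (N - 1 - j)
    have h3 : z + ((x - N + 1 : ℤ) : ℂ) + ((N - 1 - j : ℕ) : ℂ) = z + ((x - j : ℕ) : ℂ) := by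
      rw [Nat.cast_sub (by omega : j ≤ x), Nat.cast_sub (by omega : j ≤ N - 1),
        Nat.cast_sub (by omega : 1 ≤ N)]
      push_cast
      ring
    rw [h3, h1] at h2
    have h4 : ((x - j)! : ℂ) ≠ 0 := by exact_mod_cast (Nat.factorial_pos _).ne'
    have h5 : (x.descFactorial j : ℂ) ≠ 0 := by
      exact_mod_cast (Nat.descFactorial_pos.2 (by omega)).ne'
    have h6 : (Polynomial.X + Polynomial.C (z - N + 1)).eval (x : ℂ) =
        z + ((x - N + 1 : ℤ) : ℂ) := by
      simp only [Polynomial.eval_add, Polynomial.eval_X, Polynomial.eval_C]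
      push_cast
      ring
    rw [← Nat.factorial_mul_descFactorial (show j ≤ x by omega), Polynomial.eval_comp, h6]
    push_cast at h2 ⊢
    field_simp
    linear_combination h2

/-- The row factors come out, and the remaining polynomial determinant is the Vandermonde of the
nodes times a constant. That Vandermonde also occurs in `tabDet`, and `D` is the same for all
diagrams. -/
theorem onesSpec_jacobiTrudi {z : ℂ} (hz : ∀ m : ℤ, z ≠ m) (N : ℕ) :
    ∃ D : ℂ, ∀ ρ : YoungDiagram, onesSpec z (jacobiTrudi ρ N) =
      (∏ i, Complex.Gamma (z + ((node N ρ i - N + 1 : ℤ) : ℂ))) * tabDet N ρ * D := by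
  obtain ⟨D, hD⟩ := exists_det_eval_eq (N := N) (fun j : Fin N =>
    descPochhammer ℂ j * (ascPochhammer ℂ (N - 1 - j)).comp
      (Polynomial.X + Polynomial.C (z - N + 1))) (by
    intro j
    refine lt_of_le_of_lt Polynomial.natDegree_mul_le ?_
    rw [Polynomial.natDegree_comp, Polynomial.natDegree_X_add_C, ascPochhammer_natDegree,
      descPochhammer_natDegree]
    have := j.2
    omega)
  refine ⟨(∏ _i : Fin N, (Complex.Gamma z)⁻¹) * D, fun ρ => ?_⟩
  have h1 : onesSpec z (jacobiTrudi ρ N) = (Matrix.of fun i j : Fin N =>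
      onesSpec z (completeInt (shiftRow N ρ i + (j : ℕ)))).det := by
    rw [jacobiTrudi, AlgHom.map_det]
    rfl
  rw [h1, det_eq_det_node N ρ (fun k => onesSpec z (completeInt k))]
  simp_rw [onesSpec_completeInt_sub hz (Fin.is_lt _)]
  have h2 := Matrix.det_mul_column (fun i => Complex.Gamma (z + ((node N ρ i - N + 1 : ℤ) : ℂ)) /
    Complex.Gamma z * ((node N ρ i)! : ℂ)⁻¹) (Matrix.of fun i j : Fin N =>
      (descPochhammer ℂ j * (ascPochhammer ℂ (N - 1 - j)).comp
        (Polynomial.X + Polynomial.C (z - N + 1))).eval (node N ρ i : ℂ))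
  simp only [Matrix.of_apply] at h2
  rw [h2, hD (fun i => (node N ρ i : ℂ)), tabDet_eq_vandermonde, Matrix.det_vandermonde,
    Matrix.det_vandermonde]
  push_cast
  simp only [div_eq_mul_inv, Finset.prod_mul_distrib]
  ring

theorem ascPochhammer_eval_eq_prod (n : ℕ) (w : ℂ) :
    (ascPochhammer ℂ n).eval w = ∏ k ∈ Finset.range n, (w + k) := by
  induction n with
  | zero => simp
  | succ n ih => rw [ascPochhammer_succ_eval, ih, Finset.prod_range_succ]

/-- The content formula for the specialization at `(1, …, 1)`. -/
theorem onesSpec_schur {z : ℂ} (hz : ∀ m : ℤ, z ≠ m) {N : ℕ} {ρ : YoungDiagram}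
    (h : ρ.colLen 0 ≤ N) :
    onesSpec z (schur ρ) = (∏ b ∈ ρ.cells, (z + content b)) * tabDet N ρ := by
  obtain ⟨D, hD⟩ := onesSpec_jacobiTrudi hz N
  -- The empty diagram, where the Schur function and `tabDet` are both `1`, determines the unknown
  -- constant `D`.
  have h1 := hD ⊥
  rw [jacobiTrudi_eq_schur _ _ (by simp [colLen_bot]), tabDet_bot, schur, jacobiTrudi,
    Matrix.det_eq_one_of_card_eq_zero (by simp [colLen_bot]), map_one] at h1
  have h2 : ∀ i : Fin N, Complex.Gamma (z + ((node N ρ i - N + 1 : ℤ) : ℂ)) =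
      (∏ j ∈ Finset.range (ρ.rowLen (Fin.rev i)), (z + content ((Fin.rev i : ℕ), j))) *
        Complex.Gamma (z + ((node N ⊥ i - N + 1 : ℤ) : ℂ)) := by
    intro i
    have h3 := Gamma_add_natCast (ne_intCast_add hz (node N ⊥ i - N + 1))
      (ρ.rowLen (Fin.rev i))
    rw [ascPochhammer_eval_eq_prod] at h3
    rw [show z + ((node N ρ i - N + 1 : ℤ) : ℂ) = z + ((node N ⊥ i - N + 1 : ℤ) : ℂ) +
      (ρ.rowLen (Fin.rev i) : ℂ) by
        simp only [node, rowLen_bot]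
        push_cast
        ring, h3]
    congr 1
    refine Finset.prod_congr rfl fun j _ => ?_
    have h4 : ((Fin.rev i : ℕ) : ℂ) = N - (i + 1) := by
      rw [Fin.val_rev, Nat.cast_sub (by omega)]
      push_cast
      ring
    simp only [node, rowLen_bot, content]
    push_cast
    rw [h4]
    ring
  rw [← jacobiTrudi_eq_schur ρ N h, hD, Finset.prod_congr rfl fun i _ => h2 i,
    Finset.prod_mul_distrib, prod_cells ρ h, Finset.prod_range]
  have h5 := Equiv.prod_comp Fin.revPerm (fun i : Fin N => ∏ j ∈ Finset.range (ρ.rowLen i),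
      (z + content ((i : ℕ), j)))
  simp only [Fin.revPerm_apply] at h5
  rw [h5]
  rw [Complex.ofReal_one] at h1
  linear_combination -(∏ i : Fin N, ∏ j ∈ Finset.range (ρ.rowLen i),
      (z + content ((i : ℕ), j))) * tabDet N ρ * h1

/-! ### Products over pairs -/

/-- The product of `f x y` over all pairs `x > y` of elements of `A`. -/
def pairProd (f : ℕ → ℕ → ℝ) (A : Finset ℕ) : ℝ :=
  ∏ x ∈ A, ∏ y ∈ A, if y < x then f x y else 1

/-- Symmetry of `f` is needed because `a` may lie above or below the elements of `A`. -/
theorem pairProd_insert {f : ℕ → ℕ → ℝ} (hf : ∀ x y, f x y = f y x) {A : Finset ℕ} {a : ℕ}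
    (ha : a ∉ A) : pairProd f (insert a A) = pairProd f A * ∏ y ∈ A, f a y := by
  have h1 : ∏ y ∈ A, f a y =
      (∏ y ∈ A, if y < a then f a y else 1) * ∏ y ∈ A, if a < y then f y a else 1 := by
    rw [← Finset.prod_mul_distrib]
    refine Finset.prod_congr rfl fun y hy => ?_
    rcases lt_trichotomy y a with h | rfl | h
    · rw [if_pos h, if_neg (by omega), mul_one]
    · exact absurd hy ha
    · rw [if_pos h, if_neg (by omega), one_mul, hf]
  have h2 : ∀ x, (∏ y ∈ insert a A, if y < x then f x y else 1) =
      (if a < x then f x a else 1) * ∏ y ∈ A, if y < x then f x y else 1 :=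
    fun x => Finset.prod_insert ha
  rw [pairProd, Finset.prod_insert ha, h2, if_neg (lt_irrefl a), h1, one_mul, pairProd]
  simp_rw [h2]
  rw [Finset.prod_mul_distrib]
  ring

/-! ### The number of shifted standard tableaux -/

/-- The number of shifted standard tableaux with set of row lengths `S`, divided by the
factorial of the number of boxes. -/
def shiftedTab (S : Finset ℕ) : ℝ :=
  (∏ s ∈ S, ((s)! : ℝ)⁻¹) * pairProd (fun x y => |(x : ℝ) - y| / (x + y)) S

/-- The ratio of `shiftedTab (insert a S)` and `shiftedTab S`. -/
def insertRatio (a : ℕ) (S : Finset ℕ) : ℝ := ((a)! : ℝ)⁻¹ * ∏ t ∈ S, |(a : ℝ) - t| / (a + t)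

theorem shiftedTab_insert {S : Finset ℕ} {a : ℕ} (ha : a ∉ S) :
    shiftedTab (insert a S) = shiftedTab S * insertRatio a S := by
  rw [shiftedTab, pairProd_insert (fun x y => by rw [abs_sub_comm, add_comm]) ha,
    Finset.prod_insert ha, shiftedTab, insertRatio]
  ring

theorem insertRatio_of_mem {S : Finset ℕ} {a : ℕ} (ha : a ∈ S) : insertRatio a S = 0 := by
  rw [insertRatio, Finset.prod_eq_zero ha (by simp), mul_zero]

/-- A part `0` contributes `1 / 0!` and factors `t / t`, so a row that shrinks to length zero needs
no separate treatment. -/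
theorem shiftedTab_erase_zero (S : Finset ℕ) : shiftedTab (S.erase 0) = shiftedTab S := by
  by_cases h : 0 ∈ S
  · nth_rw 2 [← Finset.insert_erase h]
    rw [shiftedTab_insert (Finset.notMem_erase 0 S), insertRatio, Finset.prod_eq_one, Nat.factorial,
      Nat.cast_one, inv_one, one_mul, mul_one]
    intro t ht
    have : (t : ℝ) ≠ 0 := by exact_mod_cast Finset.ne_of_mem_erase ht
    simp [this]
  · rw [Finset.erase_eq_of_notMem h]

theorem shiftedTab_pos (S : Finset ℕ) : 0 < shiftedTab S := by
  rw [shiftedTab]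
  apply mul_pos
  · exact Finset.prod_pos fun s _ => by positivity
  · refine Finset.prod_pos fun x _ => Finset.prod_pos fun y _ => ?_
    split_ifs with h
    · have h1 : (y : ℝ) < x := by exact_mod_cast h
      have h2 : (0 : ℝ) ≤ y := by positivity
      exact div_pos (abs_pos.2 (by linarith)) (by linarith)
    · exact one_pos

theorem coeff_prod_X_sub_C {S : Finset ℕ} (f : ℕ → ℝ) (hS : 0 < S.card) :
    (∏ s ∈ S, (Polynomial.X - Polynomial.C (f s))).coeff (S.card - 1) = -∑ s ∈ S, f s :=
  Polynomial.prod_X_sub_C_coeff_card_pred S f hS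

/-- Lagrange interpolation: the summands are, up to the factor `-2`, the terms of the top
coefficient of a polynomial interpolated at the nodes `t(t - 1)`. -/
theorem sum_mul_prod_ratio {S : Finset ℕ} (h0 : 0 ∉ S) :
    ∑ a ∈ S, (a : ℝ) * ∏ t ∈ S.erase a,
      (((a : ℝ) - 1 - t) * (a + t)) / (((a : ℝ) - 1 + t) * (a - t)) = ∑ a ∈ S, (a : ℝ) := by
  rcases S.eq_empty_or_nonempty with rfl | hne
  · simp
  have hpos : ∀ t ∈ S, (1 : ℝ) ≤ t := fun t ht => by
    exact_mod_cast Nat.one_le_iff_ne_zero.2 fun h => h0 (h ▸ ht)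
  let u : ℕ → ℝ := fun t => t * (t + 1)
  let v : ℕ → ℝ := fun t => t * (t - 1)
  have hv : Set.InjOn v S := by
    intro a ha b hb hab
    have h1 := hpos a ha
    have h2 := hpos b hb
    have h3 : ((a : ℝ) - b) * (a + b - 1) = 0 := by
      simp only [v] at hab
      linear_combination hab
    rcases mul_eq_zero.1 h3 with h | h
    · exact_mod_cast sub_eq_zero.1 h
    · linarith
  -- The choice rests on `v a - u t = (a - 1 - t)(a + t)` and `v a - v t = (a - 1 + t)(a - t)`. The
  -- second product vanishes at every node; it is subtracted to bring the degree below `S.card`.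
  set P : Polynomial ℝ := ∏ s ∈ S, (Polynomial.X - Polynomial.C (u s)) -
    ∏ s ∈ S, (Polynomial.X - Polynomial.C (v s)) with hP
  have hdeg : P.degree < S.card := by
    have h1 : ∀ f : ℕ → ℝ, (∏ s ∈ S, (Polynomial.X - Polynomial.C (f s))).degree =
        (S.card : WithBot ℕ) := by
      intro f
      rw [Polynomial.degree_prod]
      simp
    have h2 : ∀ f : ℕ → ℝ, (∏ s ∈ S, (Polynomial.X - Polynomial.C (f s))).Monic :=
      fun f => Polynomial.monic_prod_X_sub_C f S
    refine lt_of_lt_of_eq (Polynomial.degree_sub_lt_left (by rw [h1, h1]) (h2 u).ne_zero ?_) (h1 u)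
    rw [(h2 u).leadingCoeff, (h2 v).leadingCoeff]
  have hc := Lagrange.coeff_eq_sum hv hdeg
  rw [Polynomial.coeff_sub, coeff_prod_X_sub_C _ hne.card_pos,
    coeff_prod_X_sub_C _ hne.card_pos] at hc
  have hterm : ∀ a ∈ S, P.eval (v a) / ∏ t ∈ S.erase a, (v a - v t) =
      -2 * ((a : ℝ) * ∏ t ∈ S.erase a,
        (((a : ℝ) - 1 - t) * (a + t)) / (((a : ℝ) - 1 + t) * (a - t))) := by
    intro a ha
    have hva : ∏ s ∈ S, (Polynomial.X - Polynomial.C (v s)).eval (v a) = 0 :=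
      Finset.prod_eq_zero ha (by simp)
    rw [hP, Polynomial.eval_sub, Polynomial.eval_prod, Polynomial.eval_prod, hva, sub_zero,
      ← Finset.mul_prod_erase _ _ ha, mul_div_assoc,
      ← Finset.prod_div_distrib]
    simp only [Polynomial.eval_sub, Polynomial.eval_X, Polynomial.eval_C]
    rw [show v a - u a = -2 * (a : ℝ) by simp only [u, v]; ring, mul_assoc]
    congr 2
    refine Finset.prod_congr rfl fun t _ => ?_
    congr 1 <;> simp only [u, v] <;> ring
  rw [Finset.sum_congr rfl hterm, ← Finset.mul_sum] at hc
  have hs : -∑ s ∈ S, u s - -∑ s ∈ S, v s = -2 * ∑ s ∈ S, (s : ℝ) := by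
    rw [← Finset.sum_neg_distrib, ← Finset.sum_neg_distrib, ← Finset.sum_sub_distrib,
      Finset.mul_sum]
    refine Finset.sum_congr rfl fun s _ => ?_
    simp only [u, v]
    ring
  rw [hs] at hc
  linarith

/-- Dividing by `shiftedTab S`, the term of `a` becomes the corresponding summand of
`sum_mul_prod_ratio`. -/
theorem shiftedTab_recursion {S : Finset ℕ} (h0 : 0 ∉ S) :
    (∑ a ∈ S, (a : ℝ)) * shiftedTab S =
      ∑ a ∈ S, shiftedTab (S.erase a) * insertRatio (a - 1) (S.erase a) := by
  rw [← sum_mul_prod_ratio h0, Finset.sum_mul]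
  refine Finset.sum_congr rfl fun a ha => ?_
  nth_rw 2 [← Finset.insert_erase ha]
  rw [shiftedTab_insert (Finset.notMem_erase a S), mul_left_comm]
  congr 1
  obtain ⟨b, rfl⟩ : ∃ b, a = b + 1 := Nat.exists_eq_succ_of_ne_zero fun h => h0 (h ▸ ha)
  rw [Nat.add_sub_cancel, insertRatio, insertRatio, Nat.factorial_succ]
  have hb : ((b + 1 : ℕ) : ℝ) ≠ 0 := by positivity
  have hb' : ((b)! : ℝ) ≠ 0 := by positivity
  rw [Nat.cast_mul, mul_inv, mul_mul_mul_comm, mul_inv_cancel_left₀ hb,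
    ← Finset.prod_mul_distrib]
  congr 1
  refine Finset.prod_congr rfl fun t ht => ?_
  have ht0 : t ≠ 0 := fun h => h0 (h ▸ Finset.mem_of_mem_erase ht)
  have htb : t ≠ b + 1 := Finset.ne_of_mem_erase ht
  have h1 : (1 : ℝ) ≤ t := by exact_mod_cast Nat.one_le_iff_ne_zero.2 ht0
  have h2 : (0 : ℝ) ≤ b := by positivity
  push_cast
  rw [add_sub_cancel_right]
  have h3 : (b : ℝ) + 1 + t ≠ 0 := by positivity
  have h4 : (b : ℝ) + t ≠ 0 := by positivity
  have h5 : (b : ℝ) + 1 - t ≠ 0 := by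
    intro h
    apply htb
    have : (t : ℝ) = (b + 1 : ℕ) := by push_cast; linarith
    exact_mod_cast this
  -- For an integer `t ≠ b + 1` the numbers `b - t` and `b + 1 - t` are never of opposite sign, so
  -- the absolute values drop out of the ratio.
  rcases Nat.lt_or_ge b t with h | h
  · have h6 : (b : ℝ) + 1 ≤ t := by exact_mod_cast h
    rw [abs_of_nonpos (by linarith), abs_of_nonpos (by linarith)]
    field_simp
  · have h6 : (t : ℝ) ≤ b := by exact_mod_cast h
    rw [abs_of_nonneg (by linarith), abs_of_nonneg (by linarith)]
    field_simp

namespace StrictPartition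

/-- The set of nonzero parts. -/
def partSet (lam : StrictPartition) : Finset ℕ := (Finset.range lam.length).image lam.part

theorem part_pos_iff {lam : StrictPartition} {i : ℕ} : 0 < lam.part i ↔ i < lam.length := by
  rw [part, length, ← YoungDiagram.mem_iff_lt_colLen, ← YoungDiagram.mem_iff_lt_rowLen]

theorem mem_partSet {lam : StrictPartition} {a : ℕ} :
    a ∈ lam.partSet ↔ 0 < a ∧ ∃ i, lam.part i = a := by
  simp only [partSet, Finset.mem_image, Finset.mem_range, ← part_pos_iff]
  constructor
  · rintro ⟨i, hi, rfl⟩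
    exact ⟨hi, i, rfl⟩
  · rintro ⟨ha, i, rfl⟩
    exact ⟨i, ha, rfl⟩

theorem zero_notMem_partSet (lam : StrictPartition) : 0 ∉ lam.partSet := by
  simp [mem_partSet]

theorem part_lt {lam : StrictPartition} {i j : ℕ} (hij : i < j) (hi : 0 < lam.part i) :
    lam.part j < lam.part i := by
  rcases Nat.eq_zero_or_pos (lam.part j) with h | h
  · omega
  · exact lam.strict i j hij h

theorem part_injective {lam : StrictPartition} {i j : ℕ} (hi : 0 < lam.part i)
    (hij : lam.part i = lam.part j) : i = j := by
  rcases lt_trichotomy i j with h | h | h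
  · have := part_lt h hi
    omega
  · exact h
  · have := part_lt h (hij ▸ hi)
    omega

theorem part_injOn (lam : StrictPartition) :
    Set.InjOn lam.part (Finset.range lam.length) := fun _ hi _ _ hij =>
  part_injective (part_pos_iff.2 (Finset.mem_range.1 (Finset.mem_coe.1 hi))) hij

theorem sum_partSet_eq (lam : StrictPartition) {M : Type*} [AddCommMonoid M] (f : ℕ → M) :
    ∑ a ∈ lam.partSet, f a = ∑ i ∈ Finset.range lam.length, f (lam.part i) :=
  Finset.sum_image lam.part_injOn

theorem sum_partSet (lam : StrictPartition) : ∑ a ∈ lam.partSet, a = lam.weight := by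
  rw [sum_partSet_eq, weight, card_eq_sum lam.diagram le_rfl]
  rfl

theorem card_partSet (lam : StrictPartition) : lam.partSet.card = lam.length := by
  rw [partSet, Finset.card_image_of_injOn lam.part_injOn, Finset.card_range]

theorem ext_diagram {lam mu : StrictPartition} (h : lam.diagram = mu.diagram) : lam = mu := by
  cases lam
  cases mu
  congr

theorem shift_injective : Function.Injective fun b : ℕ × ℕ => (b.1, b.1 + b.2) := by
  rintro ⟨a, b⟩ ⟨c, d⟩ h
  simp only [Prod.mk.injEq] at h ⊢
  omega

theorem edge_iff {mu lam : StrictPartition} : Edge mu lam ↔ YoungEdge mu.diagram lam.diagram := by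
  rw [Edge, shiftedCells, shiftedCells, Finset.image_subset_image_iff shift_injective, YoungEdge]
  rfl

theorem isGraded : IsGraded Edge empty weight where
  rank_root := rfl
  eq_root v hv := ext_diagram (youngDiagram_isGraded.eq_root _ hv)
  rank_edge u v h := h.2
  finite_pred v := by
    refine Set.Finite.of_finite_image (f := diagram) ?_ fun _ _ _ _ h => ext_diagram h
    refine (youngDiagram_isGraded.finite_pred v.diagram).subset ?_
    rintro _ ⟨u, hu, rfl⟩
    exact edge_iff.1 hu

/-- The condition for the last box of row `i` to be removable from the shifted diagram. -/
def Removable (lam : StrictPartition) (i : ℕ) : Prop :=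
  i < lam.length ∧ (lam.part (i + 1) + 1 < lam.part i ∨ lam.part i = 1)

theorem Removable.corner {lam : StrictPartition} {i : ℕ} (h : lam.Removable i) :
    lam.diagram.rowLen (i + 1) < lam.diagram.rowLen i :=
  part_lt (Nat.lt_add_one i) (part_pos_iff.2 h.1)

/-- The strict partition obtained by removing the last box of row `i`. -/
def remove (lam : StrictPartition) (i : ℕ) (h : lam.Removable i) : StrictPartition where
  diagram := truncate lam.diagram i
  strict := by
    intro j k hjk hk
    rw [rowLen_truncate h.corner] at *
    have h0 := h.corner
    have h1 := h.2
    simp only [part] at h1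
    rcases eq_or_ne k i with rfl | hki
    · rw [Function.update_self] at *
      rw [Function.update_of_ne hjk.ne]
      have := lam.strict j k hjk (by omega)
      omega
    · rw [Function.update_of_ne hki] at *
      have h2 := lam.strict j k hjk hk
      rcases eq_or_ne j i with rfl | hji
      · rw [Function.update_self]
        have := lam.diagram.rowLen_anti (j + 1) k hjk
        omega
      · rwa [Function.update_of_ne hji]

theorem part_remove {lam : StrictPartition} {i : ℕ} (h : lam.Removable i) :
    (lam.remove i h).part = Function.update lam.part i (lam.part i - 1) :=
  rowLen_truncate h.corner

theorem edge_iff_remove {mu lam : StrictPartition} :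
    Edge mu lam ↔ ∃ i, ∃ h : lam.Removable i, lam.remove i h = mu := by
  rw [edge_iff, youngEdge_iff]
  constructor
  · rintro ⟨i, hi, hmu⟩
    have h : lam.Removable i := by
      refine ⟨part_pos_iff.1 (lt_of_le_of_lt (Nat.zero_le _) hi), ?_⟩
      by_contra hcon
      simp only [part] at hcon
      have h1 := mu.strict i (i + 1) (Nat.lt_add_one i)
      rw [hmu, rowLen_truncate hi, Function.update_self,
        Function.update_of_ne (by omega)] at h1
      have := h1 (by omega)
      omega
    exact ⟨i, h, ext_diagram hmu.symm⟩
  · rintro ⟨i, h, rfl⟩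
    exact ⟨i, h.corner, rfl⟩

theorem partSet_remove {lam : StrictPartition} {i : ℕ} (h : lam.Removable i) :
    (lam.remove i h).partSet =
      (insert (lam.part i - 1) (lam.partSet.erase (lam.part i))).erase 0 := by
  have hi := part_pos_iff.2 h.1
  ext a
  simp only [mem_partSet, Finset.mem_erase, Finset.mem_insert, part_remove h]
  constructor
  · rintro ⟨ha, k, hk⟩
    refine ⟨ha.ne', ?_⟩
    rcases eq_or_ne k i with rfl | hki
    · rw [Function.update_self] at hk
      exact Or.inl hk.symm
    · rw [Function.update_of_ne hki] at hk
      refine Or.inr ⟨fun hai => hki ?_, ha, k, hk⟩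
      exact (part_injective hi (by omega)).symm
  · rintro ⟨ha, rfl | ⟨hai, _, k, hk⟩⟩
    · exact ⟨Nat.pos_of_ne_zero ha, i, Function.update_self ..⟩
    · refine ⟨Nat.pos_of_ne_zero ha, k, ?_⟩
      rwa [Function.update_of_ne]
      rintro rfl
      exact hai hk.symm

theorem sub_one_mem_of_not_removable {lam : StrictPartition} {i : ℕ} (hi : i < lam.length)
    (h : ¬ lam.Removable i) : lam.part i - 1 ∈ lam.partSet.erase (lam.part i) := by
  have h0 := part_pos_iff.2 hi
  have h1 := part_lt (Nat.lt_add_one i) h0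
  simp only [Removable, hi, true_and] at h
  rw [Finset.mem_erase, mem_partSet]
  exact ⟨by omega, by omega, i + 1, by omega⟩

theorem sub_one_notMem_of_removable {lam : StrictPartition} {i : ℕ} (h : lam.Removable i) :
    lam.part i - 1 ∉ lam.partSet.erase (lam.part i) := by
  have h0 := part_pos_iff.2 h.1
  have h2 := h.2
  rw [Finset.mem_erase, mem_partSet]
  rintro ⟨-, h3, k, hk⟩
  rcases Nat.lt_or_ge i k with hik | hik
  · have h4 : lam.part k ≤ lam.part (i + 1) := lam.diagram.rowLen_anti _ _ hik
    omega
  · have h4 : lam.part i ≤ lam.part k := lam.diagram.rowLen_anti _ _ hik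
    omega

/-- The right side runs over all rows; if a row is not removable, then `a - 1` is already a part and
`insertRatio` vanishes. -/
theorem sum_pred_shiftedTab (lam : StrictPartition) :
    ∑ mu ∈ isGraded.pred lam, shiftedTab mu.partSet = ∑ a ∈ lam.partSet,
      shiftedTab (lam.partSet.erase a) * insertRatio (a - 1) (lam.partSet.erase a) := by
  classical
  have h1 : ∀ i ∈ Finset.range lam.length,
      i ∉ {i ∈ Finset.range lam.length | lam.Removable i} →
      shiftedTab (lam.partSet.erase (lam.part i)) *
        insertRatio (lam.part i - 1) (lam.partSet.erase (lam.part i)) = 0 := by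
    intro i hi hi'
    have : ¬ lam.Removable i := fun h => hi' (Finset.mem_filter.2 ⟨hi, h⟩)
    rw [insertRatio_of_mem (sub_one_mem_of_not_removable (Finset.mem_range.1 hi) this), mul_zero]
  rw [lam.sum_partSet_eq, ← Finset.sum_subset (Finset.filter_subset _ _) h1]
  symm
  refine Finset.sum_bij (fun i hi => lam.remove i (Finset.mem_filter.1 hi).2) ?_ ?_ ?_ ?_
  · intro i hi
    rw [IsGraded.mem_pred]
    exact edge_iff_remove.2 ⟨i, _, rfl⟩
  · intro i hi j hj hij
    exact truncate_injOn lam.diagram (Finset.mem_filter.1 hi).2.corner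
      (Finset.mem_filter.1 hj).2.corner (congrArg diagram hij)
  · intro mu hmu
    rw [IsGraded.mem_pred] at hmu
    obtain ⟨i, h, rfl⟩ := edge_iff_remove.1 hmu
    exact ⟨i, Finset.mem_filter.2 ⟨Finset.mem_range.2 h.1, h⟩, rfl⟩
  · intro i hi
    have h := (Finset.mem_filter.1 hi).2
    rw [partSet_remove h, shiftedTab_erase_zero,
      shiftedTab_insert (sub_one_notMem_of_removable h)]

theorem dim_eq (lam : StrictPartition) :
    (lam.dim : ℝ) = (lam.weight)! * shiftedTab lam.partSet := by
  refine isGraded.numPaths_eq_factorial_mul (fun _ => True) (fun _ _ _ _ => trivial)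
    (fun lam => shiftedTab lam.partSet) ?_ ?_ lam trivial
  · have : empty.partSet = ∅ := by
      rw [← Finset.card_eq_zero, card_partSet]
      exact colLen_bot 0
    simp [this, shiftedTab, pairProd]
  · intro v _ _
    rw [sum_pred_shiftedTab, ← shiftedTab_recursion v.zero_notMem_partSet, ← sum_partSet]
    push_cast
    rfl

end StrictPartition

/-! ### Standard tableaux of doubled shape -/

/-- The number of standard tableaux of the diagram with set of shifted rows `A`, divided by the
factorial of the number of boxes. -/
def tabSet (A : Finset ℕ) : ℝ :=
  (∏ x ∈ A, ((x)! : ℝ)⁻¹) * pairProd (fun x y => |(x : ℝ) - y|) A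

theorem tabSet_insert {A : Finset ℕ} {a : ℕ} (ha : a ∉ A) :
    tabSet (insert a A) = tabSet A * (((a)! : ℝ)⁻¹ * ∏ y ∈ A, |(a : ℝ) - y|) := by
  rw [tabSet, pairProd_insert (fun x y => abs_sub_comm _ _) ha, Finset.prod_insert ha, tabSet]
  ring

/-- Forgetting the order of the nodes allows the double to be built up by exchanging one node at a
time. -/
theorem tabDet_eq_tabSet (N : ℕ) (ρ : YoungDiagram) :
    tabDet N ρ = tabSet (Finset.univ.image (node N ρ)) := by
  have hmono := node_strictMono N ρ
  have hinj : Set.InjOn (node N ρ) (Finset.univ : Finset (Fin N)) := hmono.injective.injOn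
  rw [tabDet_eq_vandermonde, Matrix.det_vandermonde, tabSet, pairProd, Finset.prod_image hinj,
    Finset.prod_image hinj]
  congr 1
  simp_rw [Finset.prod_image hinj]
  rw [Finset.prod_comm]
  refine Finset.prod_congr rfl fun i _ => ?_
  rw [← Finset.prod_filter]
  have h1 : Finset.Ioi i = ({j | node N ρ i < node N ρ j} : Finset (Fin N)) := by
    ext j
    simp [hmono.lt_iff_lt]
  rw [h1]
  refine Finset.prod_congr rfl fun j hj => ?_
  have h2 : (node N ρ i : ℝ) < node N ρ j := by exact_mod_cast (Finset.mem_filter.1 hj).2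
  rw [abs_of_pos (sub_pos.2 h2)]

theorem prod_range_abs_sub (M a : ℕ) :
    (a ! : ℝ) * ∏ y ∈ Finset.range M, |((M + a : ℕ) : ℝ) - y| = ((M + a)! : ℝ) := by
  rw [← Nat.factorial_mul_descFactorial (show M ≤ M + a by omega),
    Nat.descFactorial_eq_prod_range, Nat.add_sub_cancel_left]
  push_cast
  congr 1
  refine Finset.prod_congr rfl fun y hy => ?_
  have h1 : y ≤ M + a := by
    have := Finset.mem_range.1 hy
    omega
  have h2 : (y : ℝ) ≤ M + a := by exact_mod_cast h1
  rw [Nat.cast_sub h1, abs_of_nonneg (by linarith)]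
  push_cast
  rfl

theorem prod_range_erase_abs_sub (M b : ℕ) :
    ∏ y ∈ (Finset.range (M + b + 1)).erase M, |(M : ℝ) - y| = (M ! : ℝ) * b ! := by
  induction b with
  | zero =>
    have h := prod_range_abs_sub M 0
    rw [add_zero, Finset.range_add_one, Finset.erase_insert Finset.notMem_range_self]
    simpa using h
  | succ b ih =>
    rw [← add_assoc, Finset.range_add_one, Finset.erase_insert_of_ne (by omega),
      Finset.prod_insert (by simp), ih, Nat.factorial_succ, abs_sub_comm]
    push_cast
    rw [abs_of_nonneg (by ring_nf; positivity)]
    ring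

theorem tabSet_range (N : ℕ) : tabSet (Finset.range N) = 1 := by
  induction N with
  | zero => simp [tabSet, pairProd]
  | succ N ih =>
    have h := prod_range_abs_sub N 0
    simp only [add_zero, Nat.factorial_zero, Nat.cast_one, one_mul] at h
    rw [Finset.range_add_one, tabSet_insert Finset.notMem_range_self, ih, h, one_mul,
      inv_mul_cancel₀ (by positivity)]

/-- The set of shifted rows of the double of the strict partition with set of parts `S`. -/
def doubleSet (N : ℕ) (S : Finset ℕ) : Finset ℕ :=
  (Finset.range N \ S.image (N - ·)) ∪ S.image (N + ·)

theorem mem_doubleSet {N x : ℕ} {S : Finset ℕ} :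
    x ∈ doubleSet N S ↔ (x < N ∧ ∀ s ∈ S, N - s ≠ x) ∨ ∃ s ∈ S, N + s = x := by
  simp [doubleSet]

theorem sub_injOn {N : ℕ} {S : Finset ℕ} (hS : ∀ s ∈ S, 1 ≤ s ∧ s ≤ N) :
    Set.InjOn (N - ·) (S : Set ℕ) := by
  intro s hs t ht hst
  have h1 := hS s hs
  have h2 := hS t ht
  dsimp only at hst
  omega

theorem card_doubleSet {N : ℕ} {S : Finset ℕ} (hS : ∀ s ∈ S, 1 ≤ s ∧ s ≤ N) :
    (doubleSet N S).card = N := by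
  have hsub : S.image (N - ·) ⊆ Finset.range N := by
    intro x hx
    obtain ⟨s, hs, rfl⟩ := Finset.mem_image.1 hx
    have := hS s hs
    rw [Finset.mem_range]
    omega
  have hle := Finset.card_le_card hsub
  rw [doubleSet, Finset.card_union_of_disjoint, Finset.card_sdiff_of_subset hsub,
    Finset.card_image_of_injective _ (add_right_injective N), Finset.card_range] <;>
    rw [Finset.card_image_of_injOn (sub_injOn hS)] at *
  · rw [Finset.card_range] at hle
    omega
  · rw [Finset.disjoint_left]
    intro x hx hx'
    obtain ⟨s, hs, rfl⟩ := Finset.mem_image.1 hx'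
    have := Finset.mem_range.1 (Finset.mem_sdiff.1 hx).1
    omega

/-- Passing from `range N` to `doubleSet N S` exchanges each `N - s` for `N + s`; the
cross-multiplied form permits zero values of `f`. -/
theorem prod_doubleSet_erase {N a : ℕ} {S : Finset ℕ} (hS : ∀ s ∈ S, 1 ≤ s ∧ s ≤ N)
    (ha : a ∉ S) (haN : 1 ≤ a ∧ a ≤ N) (f : ℕ → ℝ) :
    (∏ y ∈ (doubleSet N S).erase (N - a), f y) * ∏ s ∈ S, f (N - s) =
      (∏ y ∈ (Finset.range N).erase (N - a), f y) * ∏ s ∈ S, f (N + s) := by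
  have hsub : S.image (N - ·) ⊆ (Finset.range N).erase (N - a) := by
    intro x hx
    obtain ⟨s, hs, rfl⟩ := Finset.mem_image.1 hx
    have h1 := hS s hs
    have h2 : s ≠ a := fun h => ha (h ▸ hs)
    rw [Finset.mem_erase, Finset.mem_range]
    omega
  have hset : (doubleSet N S).erase (N - a) =
      ((Finset.range N).erase (N - a) \ S.image (N - ·)) ∪ S.image (N + ·) := by
    ext x
    simp only [doubleSet, Finset.mem_erase, Finset.mem_union, Finset.mem_sdiff]
    constructor
    · tauto
    · rintro (h | h)
      · tauto
      · refine ⟨?_, Or.inr h⟩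
        obtain ⟨s, hs, rfl⟩ := Finset.mem_image.1 h
        omega
  rw [hset, Finset.prod_union, Finset.prod_image (add_right_injective N).injOn,
    mul_right_comm, ← Finset.prod_image (f := f) (sub_injOn hS), Finset.prod_sdiff hsub]
  rw [Finset.disjoint_left]
  intro x hx hx'
  obtain ⟨s, hs, rfl⟩ := Finset.mem_image.1 hx'
  have := Finset.mem_range.1 (Finset.mem_erase.1 (Finset.mem_sdiff.1 hx).1).2
  omega

/-- Adding the part `a` moves the single node `N - a` to `N + a`. Each `s ∈ S` then contributes `(|a
- s| / (a + s))²`, and the unmodified nodes together with the two factorials contribute `1 / (2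
a!²)`. -/
theorem tabSet_doubleSet_insert {N a : ℕ} {S : Finset ℕ} (hS : ∀ s ∈ S, 1 ≤ s ∧ s ≤ N)
    (ha : a ∉ S) (haN : 1 ≤ a ∧ a ≤ N) :
    tabSet (doubleSet N (insert a S)) =
      tabSet (doubleSet N S) * (insertRatio a S ^ 2 / 2) := by
  obtain ⟨b, rfl⟩ : ∃ b, a = b + 1 := ⟨a - 1, by omega⟩
  obtain ⟨M, rfl⟩ : ∃ M, N = M + (b + 1) := ⟨N - (b + 1), by omega⟩
  have hM : M + (b + 1) - (b + 1) = M := by omega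
  set N := M + (b + 1) with hN
  set B := (doubleSet N S).erase M with hB
  have h1 : doubleSet N S = insert M B := by
    rw [hB, Finset.insert_erase]
    rw [mem_doubleSet]
    refine Or.inl ⟨by omega, fun s hs => ?_⟩
    have h1 := hS s hs
    have h2 : s ≠ b + 1 := fun h => ha (h ▸ hs)
    omega
  have h2 : doubleSet N (insert (b + 1) S) = insert (N + (b + 1)) B := by
    ext x
    simp only [hB, Finset.mem_insert, Finset.mem_erase, mem_doubleSet, forall_eq_or_imp,
      exists_eq_or_imp, hM]
    constructor
    · rintro (h | h | h)
      · exact Or.inr ⟨h.2.1.symm, Or.inl ⟨h.1, h.2.2⟩⟩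
      · exact Or.inl h.symm
      · refine Or.inr ⟨?_, Or.inr h⟩
        obtain ⟨s, -, rfl⟩ := h
        omega
    · rintro (h | ⟨h, h' | h'⟩)
      · exact Or.inr (Or.inl h.symm)
      · exact Or.inl ⟨h'.1, h.symm, h'.2⟩
      · exact Or.inr (Or.inr h')
  have h3 : N + (b + 1) ∉ B := by
    rw [hB, Finset.mem_erase, mem_doubleSet]
    rintro ⟨-, h | ⟨s, hs, h⟩⟩
    · omega
    · exact ha (by rwa [show b + 1 = s by omega])
  rw [h1, h2, tabSet_insert h3, tabSet_insert (Finset.notMem_erase _ _), mul_assoc]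
  congr 1
  have e1 := prod_doubleSet_erase hS ha haN fun y => |((N + (b + 1) : ℕ) : ℝ) - y|
  have e2 := prod_doubleSet_erase hS ha haN fun y => |(M : ℝ) - y|
  rw [hM] at e1 e2
  rw [← hB] at e1 e2
  -- The factor `2 * (b + 1)` is the distance from `N + a` to the omitted node `M = N - a`, with `a
  -- = b + 1`.
  have p1 : ((b + 1)! : ℝ) * (2 * (b + 1) *
      ∏ y ∈ (Finset.range N).erase M, |((N + (b + 1) : ℕ) : ℝ) - y|) = ((N + (b + 1))! : ℝ) := by
    rw [← prod_range_abs_sub N (b + 1), ← Finset.mul_prod_erase (Finset.range N) _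
      (Finset.mem_range.2 (show M < N by omega))]
    congr 2
    rw [hN]
    push_cast
    rw [show (M : ℝ) + (b + 1) + (b + 1) - M = 2 * (b + 1) by ring, abs_of_nonneg (by positivity)]
  have p2 := prod_range_erase_abs_sub M b
  rw [show M + b + 1 = N by omega] at p2
  rw [p2] at e2
  have q1 : ∏ s ∈ S, |((N + (b + 1) : ℕ) : ℝ) - (N - s : ℕ)| =
      ∏ s ∈ S, (((b + 1 : ℕ) : ℝ) + s) := by
    refine Finset.prod_congr rfl fun s hs => ?_
    rw [Nat.cast_sub (hS s hs).2]
    push_cast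
    rw [show (N : ℝ) + (b + 1) - (N - s) = b + 1 + s by ring, abs_of_nonneg (by positivity)]
  have q2 : ∏ s ∈ S, |((N + (b + 1) : ℕ) : ℝ) - (N + s : ℕ)| =
      ∏ s ∈ S, |((b + 1 : ℕ) : ℝ) - s| := by
    refine Finset.prod_congr rfl fun s hs => ?_
    push_cast
    congr 1
    ring
  have q3 : ∏ s ∈ S, |(M : ℝ) - (N - s : ℕ)| = ∏ s ∈ S, |((b + 1 : ℕ) : ℝ) - s| := by
    refine Finset.prod_congr rfl fun s hs => ?_
    rw [Nat.cast_sub (hS s hs).2, abs_sub_comm, hN]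
    push_cast
    congr 1
    ring
  have q4 : ∏ s ∈ S, |(M : ℝ) - (N + s : ℕ)| = ∏ s ∈ S, (((b + 1 : ℕ) : ℝ) + s) := by
    refine Finset.prod_congr rfl fun s hs => ?_
    rw [abs_sub_comm, hN]
    push_cast
    rw [show (M : ℝ) + (b + 1) + s - M = b + 1 + s by ring, abs_of_nonneg (by positivity)]
  rw [q1, q2] at e1
  rw [q3, q4] at e2
  rw [insertRatio, Finset.prod_div_distrib]
  have hsum : ∏ s ∈ S, (((b + 1 : ℕ) : ℝ) + s) ≠ 0 :=
    (Finset.prod_pos fun s _ => by positivity).ne'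
  have hdiff : ∏ s ∈ S, |((b + 1 : ℕ) : ℝ) - s| ≠ 0 := by
    refine Finset.prod_ne_zero_iff.2 fun s hs => abs_ne_zero.2 (sub_ne_zero.2 ?_)
    intro h
    exact ha ((Nat.cast_injective h : b + 1 = s) ▸ hs)
  generalize ∏ s ∈ S, (((b + 1 : ℕ) : ℝ) + s) = Q at *
  generalize ∏ s ∈ S, |((b + 1 : ℕ) : ℝ) - s| = D at *
  generalize ∏ y ∈ B, |((N + (b + 1) : ℕ) : ℝ) - y| = E1 at *
  generalize ∏ y ∈ B, |(M : ℝ) - y| = E2 at *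
  generalize ∏ y ∈ (Finset.range N).erase M, |((N + (b + 1) : ℕ) : ℝ) - y| = R at *
  rw [← p1, Nat.factorial_succ]
  have hR : R ≠ 0 := by
    rintro rfl
    have : ((N + (b + 1))! : ℝ) ≠ 0 := by positivity
    simp at p1
    exact this p1.symm
  have hM0 : (M ! : ℝ) ≠ 0 := by positivity
  have hb0 : (b ! : ℝ) ≠ 0 := by positivity
  have hb1 : (b : ℝ) + 1 ≠ 0 := by positivity
  rw [← eq_div_iff hsum] at e1
  rw [← eq_div_iff hdiff] at e2
  rw [e1, e2]
  push_cast
  field_simp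

theorem tabSet_doubleSet {N : ℕ} {S : Finset ℕ} (hS : ∀ s ∈ S, 1 ≤ s ∧ s ≤ N) :
    tabSet (doubleSet N S) = shiftedTab S ^ 2 / 2 ^ S.card := by
  induction S using Finset.induction_on with
  | empty =>
    rw [show doubleSet N ∅ = Finset.range N by simp [doubleSet], tabSet_range]
    simp [shiftedTab, pairProd]
  | insert a S ha ih =>
    have h1 : ∀ s ∈ S, 1 ≤ s ∧ s ≤ N := fun s hs => hS s (Finset.mem_insert_of_mem hs)
    rw [tabSet_doubleSet_insert h1 ha (hS a (Finset.mem_insert_self a S)), ih h1,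
      shiftedTab_insert ha, Finset.card_insert_of_notMem ha, pow_succ 2 S.card]
    ring

namespace StrictPartition

theorem one_le_and_le_of_mem_partSet {lam : StrictPartition} {N : ℕ}
    (h : lam.double.colLen 0 ≤ N) : ∀ s ∈ lam.partSet, 1 ≤ s ∧ s ≤ N := by
  intro s hs
  obtain ⟨hs, i, rfl⟩ := mem_partSet.1 hs
  refine ⟨hs, ?_⟩
  have hi := part_pos_iff.1 hs
  have h1 := ((lam.double_frobenius 0).2 (by omega)).2
  have h2 : lam.part i ≤ lam.part 0 := lam.diagram.rowLen_anti 0 i (Nat.zero_le i)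
  omega

/-- Rows meeting the diagonal have nodes `N + λ_k` by the Frobenius coordinates; the other nodes lie
below `N` and avoid every `N - λ_j`. Both sets have `N` elements, so one inclusion suffices. -/
theorem image_node_double {lam : StrictPartition} {N : ℕ} (h : lam.double.colLen 0 ≤ N) :
    Finset.univ.image (node N lam.double) = doubleSet N lam.partSet := by
  have hle := one_le_and_le_of_mem_partSet h
  apply Finset.eq_of_subset_of_card_le
  · intro x hx
    obtain ⟨i, -, rfl⟩ := Finset.mem_image.1 hx
    set k : ℕ := (Fin.rev i).val with hk
    have hk' : k = N - (i + 1) := by rw [hk, Fin.val_rev]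
    have hi := i.2
    rw [mem_doubleSet, node, ← hk]
    rcases Nat.lt_or_ge k lam.length with hkl | hkl
    · right
      refine ⟨lam.part k, mem_partSet.2 ⟨part_pos_iff.2 hkl, k, rfl⟩, ?_⟩
      have := ((lam.double_frobenius k).2 hkl).1
      omega
    · left
      have h1 : ¬ k < lam.double.rowLen k := by
        rw [← YoungDiagram.mem_iff_lt_rowLen, (lam.double_frobenius k).1]
        omega
      refine ⟨by omega, fun s hs => ?_⟩
      have hs' := hle s hs
      obtain ⟨hs0, j, rfl⟩ := mem_partSet.1 hs
      -- A node equal to `N - λ_j` would mean `rowLen k = k + 1 - λ_j`, which contradicts `j <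
      -- rowLen k ↔ k < colLen j = j + λ_j`.
      have h2 := ((lam.double_frobenius j).2 (part_pos_iff.1 hs0)).2
      have h3 : j < lam.double.rowLen k ↔ k < lam.double.colLen j := by
        rw [← YoungDiagram.mem_iff_lt_rowLen, YoungDiagram.mem_iff_lt_colLen]
      omega
  · rw [card_doubleSet hle, Finset.card_image_of_injective _ (node_strictMono _ _).injective]
    simp

theorem tabDet_double {lam : StrictPartition} {N : ℕ} (h : lam.double.colLen 0 ≤ N) :
    tabDet N lam.double = shiftedTab lam.partSet ^ 2 / 2 ^ lam.length := by
  rw [tabDet_eq_tabSet, image_node_double h,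
    tabSet_doubleSet (one_le_and_le_of_mem_partSet h), card_partSet]

end StrictPartition

/-! ### The measures -/

theorem youngAddedContent_eq {σ ρ : YoungDiagram} {b : ℕ × ℕ} (hb : b ∉ σ.cells)
    (h : ρ.cells = insert b σ.cells) : youngAddedContent σ ρ = content b := by
  rw [youngAddedContent, h, Finset.insert_sdiff_of_notMem _ hb, Finset.sdiff_self,
    Finset.insert_empty, Finset.sum_singleton]

/-- The probability of a diagram under the `z`-measure. -/
theorem zMeasure_eq {z z' : ℂ} (hz : ∀ m : ℕ, z * z' + m ≠ 0) (ρ : YoungDiagram) :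
    zMeasure z z' ρ.card ρ = (∏ b ∈ ρ.cells, (z + content b) * (z' + content b)) /
      ((ascPochhammer ℂ ρ.card).eval (z * z') * ρ.card !) * youngDim ρ ^ 2 := by
  refine youngDiagram_isGraded.growth_eq (p := zUp z z') (w := fun ρ =>
    (∏ b ∈ ρ.cells, (z + content b) * (z' + content b)) /
      ((ascPochhammer ℂ ρ.card).eval (z * z') * ρ.card !)) ?_ ?_ ?_ ρ
  · simp [YoungDiagram.card]
  · intro u v h
    rw [zUp, if_neg h]
  · intro u v h
    obtain ⟨b, hb, hv⟩ := exists_insert h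
    rw [zUp, if_pos h, youngAddedContent_eq hb hv, h.2, hv, Finset.prod_insert hb,
      ascPochhammer_succ_eval, Nat.factorial_succ, youngDim, youngDim]
    have h1 := hz u.card
    have h2 : (u.card : ℂ) + 1 ≠ 0 := by exact_mod_cast Nat.succ_ne_zero u.card
    have h3 : (numPaths YoungEdge ⊥ u : ℂ) ≠ 0 := by
      have h4 := youngDim_eq (le_refl (u.colLen 0))
      have h5 : (0 : ℝ) < youngDim u := by
        rw [h4]
        exact mul_pos (by positivity) (tabDet_pos _ _)
      have h6 : (youngDim u : ℕ) ≠ 0 := by exact_mod_cast h5.ne'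
      exact_mod_cast h6
    push_cast
    field_simp

namespace StrictPartition

theorem addedContent_eq {mu lam : StrictPartition} {b : ℕ × ℕ} (hb : b ∉ mu.diagram.cells)
    (h : lam.diagram.cells = insert b mu.diagram.cells) : addedContent mu lam = b.2 := by
  rw [addedContent, shiftedCells, shiftedCells, ← Finset.image_sdiff _ _ shift_injective, h,
    Finset.insert_sdiff_of_notMem _ hb, Finset.sdiff_self, Finset.insert_empty,
    Finset.image_singleton, Finset.sum_singleton, content]
  push_cast
  ring

/-- The product of `c (c + 1) + α` over the contents `c` of the shifted diagram. -/
def contentProd (α : ℝ) (lam : StrictPartition) : ℝ :=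
  ∏ b ∈ lam.diagram.cells, ((b.2 : ℝ) * (b.2 + 1) + α)

theorem contentProd_pos {α : ℝ} (hα : 0 < α) (lam : StrictPartition) :
    0 < lam.contentProd α :=
  Finset.prod_pos fun b _ => by positivity

theorem measure_eq {α : ℝ} (hα : 0 < α) (lam : StrictPartition) :
    lam.measure α lam.weight = lam.contentProd α /
      ((ascPochhammer ℝ lam.weight).eval (α / 2) * (lam.weight)! * 2 ^ lam.length) *
        lam.dim ^ 2 := by
  refine isGraded.growth_eq (p := up α) (w := fun lam => lam.contentProd α /
      ((ascPochhammer ℝ lam.weight).eval (α / 2) * (lam.weight)! * 2 ^ lam.length)) ?_ ?_ ?_ lam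
  · have h1 : empty.length = 0 := colLen_bot 0
    have h2 : empty.weight = 0 := rfl
    have h3 : empty.diagram = ⊥ := rfl
    simp [contentProd, h1, h2, h3]
  · intro u v h
    rw [up, if_neg h]
  · intro u v h
    obtain ⟨b, hb, hv⟩ := exists_insert (edge_iff.1 h)
    rw [up, if_pos h, addedContent_eq hb hv, h.2, contentProd, contentProd, hv,
      Finset.prod_insert hb, ascPochhammer_succ_eval, Nat.factorial_succ, plancherelUp, dim, dim,
      zpow_add₀ two_ne_zero, zpow_sub₀ two_ne_zero, zpow_natCast, zpow_natCast, zpow_one]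
    have h1 : 2 * (u.weight : ℝ) + α ≠ 0 := by positivity
    have h2 : α / 2 + (u.weight : ℝ) ≠ 0 := by positivity
    have h3 : (numPaths Edge empty u : ℝ) ≠ 0 := by
      have h4 := dim_eq u
      rw [dim] at h4
      rw [h4]
      exact (mul_pos (by positivity) (shiftedTab_pos _)).ne'
    have h5 := (ascPochhammer_pos u.weight (α / 2) (by positivity)).ne'
    push_cast
    -- The `2` lost in passing from `2|μ| + α` to the Pochhammer factor is the `+ 1` in the exponent
    -- of `2`; what remains of that power telescopes to `2^{-ℓ}`.
    rw [show α / 2 + (u.weight : ℝ) = (2 * u.weight + α) / 2 by ring]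
    field_simp

/-- In unshifted coordinates the box `b` has content `b.2` in the shifted diagram; its copies above
and below the diagonal have contents `b.2 + 1` and `-b.2`. -/
theorem prod_double {M : Type*} [CommMonoid M] (lam : StrictPartition) (f : ℤ → M) :
    ∏ b ∈ lam.double.cells, f (content b) =
      ∏ b ∈ lam.diagram.cells, f (b.2 + 1) * f (-b.2) := by
  rw [double, Finset.prod_union, Finset.prod_image, Finset.prod_image, ← Finset.prod_mul_distrib]
  · refine Finset.prod_congr rfl fun b _ => ?_
    congr 2 <;> simp only [content] <;> push_cast <;> ring
  · rintro ⟨a, b⟩ _ ⟨c, d⟩ _ h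
    simp only [Prod.mk.injEq] at h ⊢
    omega
  · rintro ⟨a, b⟩ _ ⟨c, d⟩ _ h
    simp only [Prod.mk.injEq] at h ⊢
    omega
  · rw [Finset.disjoint_left]
    intro x hx hx'
    obtain ⟨a, -, rfl⟩ := Finset.mem_image.1 hx
    obtain ⟨c, -, h⟩ := Finset.mem_image.1 hx'
    simp only [Prod.mk.injEq] at h
    omega

theorem card_double (lam : StrictPartition) : lam.double.card = 2 * lam.weight := by
  have h := congrArg Multiplicative.toAdd (lam.prod_double fun _ => Multiplicative.ofAdd 1)
  simp only [Finset.prod_const, ← ofAdd_add, ← ofAdd_nsmul, toAdd_ofAdd] at h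
  rw [YoungDiagram.card, weight, YoungDiagram.card]
  simp only [smul_eq_mul, mul_one] at h
  omega

/-- The measure of a strict partition through the number of standard tableaux of its double. -/
theorem measure_eq_tabDet {α : ℝ} (hα : 0 < α) {lam : StrictPartition} {N : ℕ}
    (h : lam.double.colLen 0 ≤ N) :
    lam.measure α lam.weight = (lam.weight)! / (ascPochhammer ℝ lam.weight).eval (α / 2) *
      (lam.contentProd α * tabDet N lam.double) := by
  rw [measure_eq hα, dim_eq, tabDet_double h]
  have h1 : ((lam.weight)! : ℝ) ≠ 0 := by positivity
  have h2 := (ascPochhammer_pos lam.weight (α / 2) (by positivity)).ne'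
  field_simp

end StrictPartition

/-! ### The parameters -/

/-- Only the square of `ν` matters below, so the branch of the root is irrelevant. -/
theorem nu_sq (α : ℝ) : nu α ^ 2 = (1 - 4 * (α : ℂ)) / 4 := by
  have h := Complex.cpow_nat_inv_pow (1 - 4 * (α : ℂ)) two_ne_zero
  rw [nu, mul_pow, one_div (2 : ℂ)]
  push_cast at h
  rw [h]
  ring

theorem zParam_mul_zParam' (α : ℝ) : zParam α * zParam' α = α := by
  rw [zParam, zParam']
  linear_combination -nu_sq α

/-- An integer value `m` would give `α = -m(m + 1) ≤ 0`. This supplies the hypothesis of the content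
formula. -/
theorem zParam_ne_intCast {α : ℝ} (hα : 0 < α) (m : ℤ) : zParam α ≠ m := by
  intro h
  have h1 : zParam' α = -1 - m := by
    rw [← h, zParam, zParam']
    ring
  have h2 := zParam_mul_zParam' α
  rw [h, h1] at h2
  have h3 : (m : ℝ) * (-1 - m) = α := by exact_mod_cast h2
  have h4 : 0 ≤ m * (m + 1) := by
    rcases le_or_gt 0 m with hm | hm
    · positivity
    · exact mul_nonneg_of_nonpos_of_nonpos hm.le (by omega)
  have h5 : (0 : ℝ) ≤ m * (m + 1) := by exact_mod_cast h4
  linarith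

theorem prod_zParam_double (α : ℝ) (lam : StrictPartition) :
    ∏ b ∈ lam.double.cells, (zParam α + content b) =
      (-1) ^ lam.weight * (lam.contentProd α : ℂ) := by
  rw [lam.prod_double fun c => zParam α + c, StrictPartition.weight, YoungDiagram.card,
    ← Finset.prod_const, StrictPartition.contentProd, Complex.ofReal_prod,
    ← Finset.prod_mul_distrib]
  refine Finset.prod_congr rfl fun b _ => ?_
  push_cast
  rw [zParam]
  linear_combination nu_sq α

theorem prod_zParam_mul_double (α : ℝ) (lam : StrictPartition) :
    ∏ b ∈ lam.double.cells, (zParam α + content b) * (zParam' α + content b) =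
      (lam.contentProd α : ℂ) ^ 2 := by
  rw [lam.prod_double fun c => (zParam α + c) * (zParam' α + c), StrictPartition.contentProd,
    Complex.ofReal_prod, ← Finset.prod_pow]
  refine Finset.prod_congr rfl fun b _ => ?_
  have h1 (c : ℂ) : (zParam α + c) * (zParam' α + c) = c * (c - 1) + α := by
    rw [← zParam_mul_zParam', zParam, zParam']
    ring
  rw [h1, h1]
  push_cast
  ring

theorem ofReal_ascPochhammer_eval (n : ℕ) (x : ℝ) :
    (((ascPochhammer ℝ n).eval x : ℝ) : ℂ) = (ascPochhammer ℂ n).eval (x : ℂ) := by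
  induction n with
  | zero => simp
  | succ n ih => rw [ascPochhammer_succ_eval, ascPochhammer_succ_eval, ← ih]; push_cast; rfl

/-- The `z`-measure of a doubled strict partition. -/
theorem zMeasure_double {α : ℝ} (hα : 0 < α) {lam : StrictPartition} {N : ℕ}
    (h : lam.double.colLen 0 ≤ N) :
    zMeasure (zParam α) (zParam' α) (2 * lam.weight) lam.double =
      (((lam.contentProd α * tabDet N lam.double) ^ 2 *
        ((2 * lam.weight)! / (ascPochhammer ℝ (2 * lam.weight)).eval α) : ℝ) : ℂ) := by
  have h1 : ∀ m : ℕ, zParam α * zParam' α + m ≠ 0 := by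
    intro m
    rw [zParam_mul_zParam']
    have : α + m ≠ 0 := by positivity
    exact_mod_cast this
  have h2 : (youngDim lam.double : ℂ) = ((lam.double.card ! * tabDet N lam.double : ℝ) : ℂ) := by
    rw [← youngDim_eq h]
    simp
  rw [← lam.card_double, zMeasure_eq h1, prod_zParam_mul_double, zParam_mul_zParam', h2,
    ← ofReal_ascPochhammer_eval]
  have h3 : (lam.double.card ! : ℂ) ≠ 0 := by exact_mod_cast (Nat.factorial_pos _).ne'
  push_cast
  field_simp

end StrictDoubling

end

/-! ### Comparison of the three closed forms -/

theorem mainTheorem5 (α : ℝ) (hα : 0 < α) (n : ℕ) :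
    (∀ lam : StrictDoubling.StrictPartition, lam.weight = n →
      (lam.measure α n : ℂ) =
        (-1) ^ n * (n ! : ℂ) / (ascPochhammer ℂ n).eval ((α : ℂ) / 2) *
          StrictDoubling.onesSpec (StrictDoubling.nu α - 1 / 2)
            (StrictDoubling.schur lam.double)) ∧
    ∃ C : ℝ, 0 < C ∧
      ∀ lam : StrictDoubling.StrictPartition, lam.weight = n →
        ∃ w : ℝ, 0 < w ∧
          StrictDoubling.zMeasure (StrictDoubling.zParam α) (StrictDoubling.zParam' α)
            (2 * n) lam.double = (w : ℂ) ∧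
          lam.measure α n = C * √w := by
  have hP := ascPochhammer_pos n (α / 2) (by positivity)
  have hK : 0 < ((2 * n)! : ℝ) / (ascPochhammer ℝ (2 * n)).eval α :=
    div_pos (by positivity) (ascPochhammer_pos _ _ hα)
  -- The strict measure is `n! / (α/2)_n * Q` and the `z`-measure is `Q² * (2n)! / (α)_{2n}` with
  -- the same `Q > 0`; the constant is the quotient of the first prefactor by the root of the
  -- second.
  refine ⟨?_, (n ! : ℝ) / (ascPochhammer ℝ n).eval (α / 2) /
    √(((2 * n)! : ℝ) / (ascPochhammer ℝ (2 * n)).eval α), ?_, ?_⟩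
  · rintro lam rfl
    have h1 := StrictDoubling.onesSpec_schur (StrictDoubling.zParam_ne_intCast hα)
      (le_refl (lam.double.colLen 0))
    rw [StrictDoubling.prod_zParam_double] at h1
    rw [StrictDoubling.StrictPartition.measure_eq_tabDet hα le_rfl, ← StrictDoubling.zParam, h1]
    push_cast [StrictDoubling.ofReal_ascPochhammer_eval]
    -- The sign of the prefactor cancels the sign of the content product of the double.
    have h2 : ((-1 : ℂ) ^ lam.weight) ^ 2 = 1 := by rw [← pow_mul, mul_comm, pow_mul]; simp
    linear_combination -((lam.weight)! : ℂ) / (ascPochhammer ℂ lam.weight).eval ((α : ℂ) / 2) *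
      (lam.contentProd α * StrictDoubling.tabDet (lam.double.colLen 0) lam.double) * h2
  · exact div_pos (div_pos (by positivity) hP) (Real.sqrt_pos.2 hK)
  · rintro lam rfl
    have hQ := mul_pos (lam.contentProd_pos hα)
      (StrictDoubling.tabDet_pos (lam.double.colLen 0) lam.double)
    refine ⟨_, mul_pos (pow_pos hQ 2) hK, StrictDoubling.zMeasure_double hα le_rfl, ?_⟩
    rw [StrictDoubling.StrictPartition.measure_eq_tabDet hα le_rfl, Real.sqrt_mul (by positivity),
      Real.sqrt_sq hQ.le]
    have := (Real.sqrt_pos.2 hK).ne'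
    field_simp
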